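/- Let $a>0$, $X=L^2((0,1);\mathbb C)$ with $\langle f,g\rangle=\int_0^1 f\bar g$, $\mathcal U=L^\infty(\mathbb R_+,\mathbb C)$, and consider the one-dimensional heat equation with Dirichlet boundary input $$x_t(\xi,t)=a\,x_{\xi\xi}(\xi,t),\quad x(0,t)=0,\quad x(1,t)=u(t),\quad x(\cdot,0)=x_0 .$$ Let $Af=af''$ with $D(A)=\{f\in H^2(0,1): f(0)=f(1)=0\}$. Then $0\in\rho(A)$ and $A$ generates a $C_0$-semigroup $(T(t))_{t\ge0}$ on $X$. Let $X_{-1}$ be the completion of $X$ in the norm $\|A^{-1}\cdot\|_X$, let $(T_{-1}(t))_{t\ge 0}$ be the extension of the semigroup to $X_{-1}$, with generator $A_{-1}$. There is a $B\in L(\mathbb C,X_{-1})$ that represents the boundary input, i.e. $az''=A_{-1}z+B\,z(1)$ in $X_{-1}$ for every $z\in H^2(0,1)$ with $z(0)=0$, and the mild solutions $$\phi(t,x_0,u)=T(t)x_0+\int_0^tT_{-1}(t-s)Bu(s)\,ds$$ take values in $X$ and define a forward complete control system $(X,\mathcal U,\phi)$ (identity property, causality, continuity in $t$, cocycle property). The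 function $$V(x)=-\langle A^{-1}x,x\rangle=\frac1a\int_0^1\Big(\int_\xi^1(\xi-\tau)x(\tau)\,d\tau+(1-\xi)\int_0^1\tau x(\tau)\,d\tau\Big)\overline{x(\xi)}\,d\xi$$ is real-valued and is a non-coercive ISS Lyapunov function for this system: $V:X\to[0,\infty)$ is continuous and there are $\psi_2,\alpha\in\mathcal K_\infty$ and $\sigma\in\mathcal K$ with $0<V(x)\le\psi_2(\|x\|)$ for all $x\ne0$ and $$\limsup_{t\searrow0}\frac{V(\phi(t,x,u))-V(x)}{t}\le-\alpha(\|x\|)+\sigma(\|u\|_\infty)\qquad\text{for all }x\in X,\ u\in\mathcal U$$ (a lower bound of $V(x)$ by a $\mathcal K_\infty$-function of $\|x\|$ is not required). Moreover the system is input-to-state stable: there are $\beta\in\mathcal{KL}$ and $\gamma\in\mathcal K$ with $\|\phi(t,x,u)\|\le\beta(\|x\|,t)+\gamma(\|u\|_\infty)$ for all $x\in X$, $u\in\mathcal U$, $t\ge0$. -/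

import Mathlib

open MeasureTheory Set Filter Topology
open scoped ContDiff ENNReal ComplexConjugate

noncomputable section

namespace HeatISS

/-! ### Comparison functions (as functions on `[0, ∞)`) -/

/-- Class `K`: continuous, strictly increasing on `[0, ∞)` and zero at zero. -/
def ClassK (γ : ℝ → ℝ) : Prop :=
  ContinuousOn γ (Ici 0) ∧ StrictMonoOn γ (Ici 0) ∧ γ 0 = 0

/-- Class `K∞`: unbounded functions of class `K`. -/
def ClassKInf (γ : ℝ → ℝ) : Prop :=
  ClassK γ ∧ ∀ M : ℝ, ∃ r : ℝ, 0 ≤ r ∧ M < γ r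

/-- Class `L`: continuous, strictly decreasing on `[0, ∞)` with limit zero at infinity. -/
def ClassL (γ : ℝ → ℝ) : Prop :=
  ContinuousOn γ (Ici 0) ∧ StrictAntiOn γ (Ici 0) ∧ Tendsto γ atTop (𝓝 0)

/-- Class `KL`. -/
def ClassKL (β : ℝ → ℝ → ℝ) : Prop :=
  (∀ t : ℝ, 0 ≤ t → ClassK (fun r => β r t)) ∧ ∀ r : ℝ, 0 < r → ClassL (β r)

/-! ### Control systems with input space `L^∞(ℝ₊, U)` -/

/-- The input space `L^∞(ℝ₊, U)`. -/
abbrev Input (U : Type*) [NormedAddCommGroup U] : Type _ :=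
  Lp U ∞ (volume.restrict (Ici (0 : ℝ)))

theorem shift_quasiMeasurePreserving (t : ℝ) (ht : 0 ≤ t) :
    Measure.QuasiMeasurePreserving (fun s : ℝ => t + s)
      (volume.restrict (Ici (0 : ℝ))) (volume.restrict (Ici (0 : ℝ))) :=
  (measurePreserving_add_left volume t).quasiMeasurePreserving.restrict
    (fun _ hs => add_nonneg ht hs)

theorem memLp_shift {U : Type*} [NormedAddCommGroup U] (t : ℝ) (ht : 0 ≤ t) (u : Input U) :
    MemLp (fun s : ℝ => u (t + s)) ∞ (volume.restrict (Ici (0 : ℝ))) := by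
  have hq := shift_quasiMeasurePreserving t ht
  refine memLp_top_of_bound
    ((Lp.aestronglyMeasurable u).comp_quasiMeasurePreserving hq) ‖u‖ ?_
  refine hq.ae (p := fun s => ‖u s‖ ≤ ‖u‖) ?_
  have hfin : eLpNorm u ⊤ (volume.restrict (Ici (0 : ℝ))) ≠ ⊤ := (Lp.memLp u).2.ne
  filter_upwards [ae_le_eLpNormEssSup (f := u) (μ := volume.restrict (Ici (0 : ℝ)))] with s hs
  rw [Lp.norm_def]
  rw [← eLpNorm_exponent_top] at hs
  simpa using ENNReal.toReal_mono hfin hs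

/-- The shifted input `u(t + ·)`, for `t ≥ 0`. -/
def shift {U : Type*} [NormedAddCommGroup U] (t : ℝ) (ht : 0 ≤ t) (u : Input U) : Input U :=
  (memLp_shift t ht u).toLp

/-- `(X, L^∞(ℝ₊, U), φ)` is a forward complete control system. Only the values `φ t x u` with
`t ≥ 0` are relevant. -/
structure IsForwardComplete {X U : Type*} [NormedAddCommGroup X] [NormedAddCommGroup U]
    (φ : ℝ → X → Input U → X) : Prop where
  identity : ∀ (x : X) (u : Input U), φ 0 x u = x
  causality : ∀ (t : ℝ), 0 ≤ t → ∀ (x : X) (u v : Input U),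
    (∀ᵐ s ∂(volume.restrict (Icc (0 : ℝ) t)), u s = v s) → φ t x u = φ t x v
  continuity : ∀ (x : X) (u : Input U), ContinuousOn (fun t => φ t x u) (Ici 0)
  cocycle : ∀ (t : ℝ) (ht : 0 ≤ t) (h : ℝ), 0 ≤ h → ∀ (x : X) (u : Input U),
    φ h (φ t x u) (shift t ht u) = φ (t + h) x u

/-- Input-to-state stability. -/
def IsISS {X U : Type*} [NormedAddCommGroup X] [NormedAddCommGroup U]
    (φ : ℝ → X → Input U → X) : Prop :=
  ∃ β : ℝ → ℝ → ℝ, ∃ γ : ℝ → ℝ, ClassKL β ∧ ClassK γ ∧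
    ∀ (x : X) (u : Input U) (t : ℝ), 0 ≤ t → ‖φ t x u‖ ≤ β ‖x‖ t + γ ‖u‖

/-- The right-hand upper Dini derivative of `V` at `x` along the trajectory with input `u`,
as an extended real number. -/
def diniDeriv {X U : Type*} [NormedAddCommGroup U]
    (φ : ℝ → X → Input U → X) (V : X → ℝ) (x : X) (u : Input U) : EReal :=
  limsup (fun t : ℝ => (((1 / t) * (V (φ t x u) - V x) : ℝ) : EReal)) (𝓝[>] 0)

/-- `V` is a non-coercive ISS Lyapunov function (a lower bound of `V(x)` by a `K∞`-function of
`‖x‖` is not required). -/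
def IsNoncoerciveISSLyapunov {X U : Type*} [NormedAddCommGroup X] [NormedAddCommGroup U]
    (φ : ℝ → X → Input U → X) (V : X → ℝ) : Prop :=
  Continuous V ∧ (∀ x, 0 ≤ V x) ∧
  ∃ ψ₂ α σ : ℝ → ℝ, ClassKInf ψ₂ ∧ ClassKInf α ∧ ClassK σ ∧
    (∀ x : X, x ≠ 0 → 0 < V x ∧ V x ≤ ψ₂ ‖x‖) ∧
    ∀ (x : X) (u : Input U), diniDeriv φ V x u ≤ ((-α ‖x‖ + σ ‖u‖ : ℝ) : EReal)

/-! ### Semigroups, generators, resolvents -/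

/-- `(T(t))_{t ≥ 0}` is a strongly continuous semigroup. -/
structure IsC0Semigroup {X : Type*} [NormedAddCommGroup X] [NormedSpace ℂ X]
    (T : ℝ → X →L[ℂ] X) : Prop where
  map_zero : T 0 = ContinuousLinearMap.id ℂ X
  map_add : ∀ s t : ℝ, 0 ≤ s → 0 ≤ t → T (s + t) = (T s).comp (T t)
  continuousOn : ∀ x : X, ContinuousOn (fun t => T t x) (Ici 0)

/-- `x` lies in the domain of the infinitesimal generator of `S` and the generator maps `x`
to `y`. -/
def GeneratorMapsTo {X : Type*} [NormedAddCommGroup X] [NormedSpace ℂ X]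
    (S : ℝ → X → X) (x y : X) : Prop :=
  Tendsto (fun h : ℝ => ((1 / h : ℝ) : ℂ) • (S h x - x)) (𝓝[>] 0) (𝓝 y)

/-- `A` (with its domain) is the infinitesimal generator of `T`. -/
def IsGenerator {X : Type*} [NormedAddCommGroup X] [NormedSpace ℂ X]
    (A : X →ₗ.[ℂ] X) (T : ℝ → X →L[ℂ] X) : Prop :=
  ∀ x y : X, (x, y) ∈ A.graph ↔ GeneratorMapsTo (fun t => T t) x y

/-- `R` is the bounded inverse of `β I - A`. -/
def IsResolventOp {X : Type*} [NormedAddCommGroup X] [NormedSpace ℂ X]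
    (A : X →ₗ.[ℂ] X) (β : ℂ) (R : X →L[ℂ] X) : Prop :=
  (∀ x : X, ∃ h : R x ∈ A.domain, β • R x - A ⟨R x, h⟩ = x) ∧
  ∀ x : A.domain, R (β • (x : X) - A x) = x

/-- `β ∈ ρ(A)`. -/
def InResolventSet {X : Type*} [NormedAddCommGroup X] [NormedSpace ℂ X]
    (A : X →ₗ.[ℂ] X) (β : ℂ) : Prop :=
  ∃ R : X →L[ℂ] X, IsResolventOp A β R

open Classical in
/-- The resolvent `(β I - A)⁻¹` (set to `0` if `β ∉ ρ(A)`). -/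
def resolventOp {X : Type*} [NormedAddCommGroup X] [NormedSpace ℂ X]
    (A : X →ₗ.[ℂ] X) (β : ℂ) : X →L[ℂ] X :=
  if h : InResolventSet A β then h.choose else 0

theorem IsResolventOp.unique {X : Type*} [NormedAddCommGroup X] [NormedSpace ℂ X]
    {A : X →ₗ.[ℂ] X} {β : ℂ} {R R' : X →L[ℂ] X}
    (h : IsResolventOp A β R) (h' : IsResolventOp A β R') : R = R' := by
  ext x
  obtain ⟨hx, hx'⟩ := h'.1 x
  have := h.2 ⟨R' x, hx⟩
  simpa [hx'] using this

/-! ### The extrapolation space `X₋₁` and mild solutions -/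

/-- The vector space `X`, to be equipped with the norm `x ↦ ‖(β I - A)⁻¹ x‖`. -/
def PreExtrapolation {X : Type*} [NormedAddCommGroup X] [NormedSpace ℂ X]
    (_A : X →ₗ.[ℂ] X) (_β : ℂ) : Type _ := X

section PreExtrapolation

variable {X : Type*} [NormedAddCommGroup X] [NormedSpace ℂ X] (A : X →ₗ.[ℂ] X) (β : ℂ)

instance : AddCommGroup (PreExtrapolation A β) := inferInstanceAs (AddCommGroup X)

instance : Module ℂ (PreExtrapolation A β) := inferInstanceAs (Module ℂ X)

/-- `(β I - A)⁻¹` as a map from `PreExtrapolation A β` to `X`. -/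
def preResolvent : PreExtrapolation A β →ₗ[ℂ] X := (resolventOp A β : X →ₗ[ℂ] X)

instance : SeminormedAddCommGroup (PreExtrapolation A β) :=
  SeminormedAddCommGroup.induced (PreExtrapolation A β) X (preResolvent A β)

instance : NormedSpace ℂ (PreExtrapolation A β) :=
  NormedSpace.induced ℂ (PreExtrapolation A β) X (preResolvent A β)

/-- The extrapolation space `X₋₁`: the completion of `X` with respect to
`‖x‖₋₁ = ‖(β I - A)⁻¹ x‖`. -/
abbrev Extrapolation : Type _ := UniformSpace.Completion (PreExtrapolation A β)

/-- The canonical embedding `X → X₋₁`. -/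
def emb (x : X) : Extrapolation A β :=
  ((show PreExtrapolation A β from x : PreExtrapolation A β) : Extrapolation A β)

theorem norm_emb (x : X) : ‖emb A β x‖ = ‖resolventOp A β x‖ :=
  UniformSpace.Completion.norm_coe (show PreExtrapolation A β from x)

/-- The extension of a bounded operator `S` on `X` to `X₋₁` by continuity (it exists
if `S` commutes with the resolvent, as do the operators of the semigroup generated by `A`). -/
def extend (S : X →L[ℂ] X) : Extrapolation A β → Extrapolation A β :=
  UniformSpace.Completion.map
    (fun x : PreExtrapolation A β => (show PreExtrapolation A β from S (show X from x)))

end PreExtrapolation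

theorem extend_emb {X : Type*} [NormedAddCommGroup X] [NormedSpace ℂ X] (A : X →ₗ.[ℂ] X) (β : ℂ)
    (S : X →L[ℂ] X) (hS : ∀ x, resolventOp A β (S x) = S (resolventOp A β x)) (x : X) :
    extend A β S (emb A β x) = emb A β (S x) := by
  let f : PreExtrapolation A β →ₗ[ℂ] PreExtrapolation A β := (S : X →ₗ[ℂ] X)
  have hf : UniformContinuous f :=
    (f.mkContinuous ‖S‖ (fun y => by
      change ‖resolventOp A β (S y)‖ ≤ ‖S‖ * ‖resolventOp A β y‖
      exact (congrArg norm (hS y)).trans_le (S.le_opNorm _))).uniformContinuous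
  exact UniformSpace.Completion.map_coe hf (show PreExtrapolation A β from x)

/-- The function `φ` consists of the mild solutions of `ẋ = A x + B u`:
`φ(t, x, u) = T(t) x + ∫₀ᵗ T₋₁(t - s) B u(s) ds`, an identity in `X₋₁`
in which the left-hand side belongs to `X`. -/
def IsMildSolutionMap {X U : Type*} [NormedAddCommGroup X] [NormedSpace ℂ X]
    [NormedAddCommGroup U] [NormedSpace ℂ U]
    (A : X →ₗ.[ℂ] X) (β : ℂ) (T : ℝ → X →L[ℂ] X) (B : U →L[ℂ] Extrapolation A β)
    (φ : ℝ → X → Input U → X) : Prop :=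
  ∀ (t : ℝ), 0 ≤ t → ∀ (x : X) (u : Input U),
    IntervalIntegrable (fun s => extend A β (T (t - s)) (B (u s))) volume 0 t ∧
    emb A β (φ t x u) =
      emb A β (T t x) + ∫ s in (0 : ℝ)..t, extend A β (T (t - s)) (B (u s))

/-! ### The heat equation -/

/-- The state space `L²(0,1)` of complex-valued functions. -/
abbrev L2 : Type := Lp ℂ 2 (volume.restrict (Ioo (0 : ℝ) 1))

/-- `g ∈ L²(0,1)` is the weak derivative of `f ∈ L²(0,1)`. -/
def IsWeakDeriv (f g : L2) : Prop :=
  ∀ η : ℝ → ℝ, ContDiff ℝ ∞ η → HasCompactSupport η → tsupport η ⊆ Ioo 0 1 →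
    ∫ ξ in Ioo (0 : ℝ) 1, deriv η ξ • f ξ = -∫ ξ in Ioo (0 : ℝ) 1, η ξ • g ξ

/-- `f` has a representative that is continuous on `[0,1]` and takes the value `c` at `ξ`. -/
def HasValueAt (f : L2) (ξ : ℝ) (c : ℂ) : Prop :=
  ∃ F : ℝ → ℂ, ContinuousOn F (Icc 0 1) ∧
    f =ᵐ[volume.restrict (Ioo (0 : ℝ) 1)] F ∧ F ξ = c

/-- `f ∈ H²(0,1)` with weak second derivative `g`. -/
def HasSecondWeakDeriv (f g : L2) : Prop :=
  ∃ f' : L2, IsWeakDeriv f f' ∧ IsWeakDeriv f' g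

theorem integrable_test_smul (f : L2) (η : ℝ → ℝ) (h : Continuous η) (hc : HasCompactSupport η) :
    Integrable (fun ξ => η ξ • f ξ) (volume.restrict (Ioo (0 : ℝ) 1)) := by
  obtain ⟨C, hC⟩ := h.bounded_above_of_compact_support hc
  exact ((Lp.memLp f).integrable (by norm_num)).bdd_smul C h.aestronglyMeasurable
    (Eventually.of_forall hC)

theorem IsWeakDeriv.add {f g f₂ g₂ : L2} (h : IsWeakDeriv f g) (h₂ : IsWeakDeriv f₂ g₂) :
    IsWeakDeriv (f + f₂) (g + g₂) := by
  intro η h1 h2 h3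
  have hd : Continuous (deriv η) := h1.continuous_deriv (by simp)
  have e1 : ∫ ξ in Ioo (0 : ℝ) 1, deriv η ξ • (f + f₂ : L2) ξ
      = ∫ ξ in Ioo (0 : ℝ) 1, (deriv η ξ • f ξ + deriv η ξ • f₂ ξ) := by
    refine integral_congr_ae ?_
    filter_upwards [Lp.coeFn_add f f₂] with ξ hξ
    rw [hξ, Pi.add_apply, smul_add]
  have e2 : ∫ ξ in Ioo (0 : ℝ) 1, η ξ • (g + g₂ : L2) ξ
      = ∫ ξ in Ioo (0 : ℝ) 1, (η ξ • g ξ + η ξ • g₂ ξ) := by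
    refine integral_congr_ae ?_
    filter_upwards [Lp.coeFn_add g g₂] with ξ hξ
    rw [hξ, Pi.add_apply, smul_add]
  rw [e1, e2, integral_add (integrable_test_smul f _ hd h2.deriv)
    (integrable_test_smul f₂ _ hd h2.deriv),
    integral_add (integrable_test_smul g _ h1.continuous h2)
    (integrable_test_smul g₂ _ h1.continuous h2), h η h1 h2 h3, h₂ η h1 h2 h3]
  ring

theorem IsWeakDeriv.smul {f g : L2} (c : ℂ) (h : IsWeakDeriv f g) :
    IsWeakDeriv (c • f) (c • g) := by
  intro η h1 h2 h3
  have e1 : ∫ ξ in Ioo (0 : ℝ) 1, deriv η ξ • (c • f : L2) ξ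
      = ∫ ξ in Ioo (0 : ℝ) 1, c • (deriv η ξ • f ξ) := by
    refine integral_congr_ae ?_
    filter_upwards [Lp.coeFn_smul c f] with ξ hξ
    rw [hξ, Pi.smul_apply, smul_comm]
  have e2 : ∫ ξ in Ioo (0 : ℝ) 1, η ξ • (c • g : L2) ξ
      = ∫ ξ in Ioo (0 : ℝ) 1, c • (η ξ • g ξ) := by
    refine integral_congr_ae ?_
    filter_upwards [Lp.coeFn_smul c g] with ξ hξ
    rw [hξ, Pi.smul_apply, smul_comm]
  rw [e1, e2, integral_smul, integral_smul, h η h1 h2 h3, smul_neg]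

theorem HasValueAt.add {f g : L2} {ξ : ℝ} {c d : ℂ} (hf : HasValueAt f ξ c)
    (hg : HasValueAt g ξ d) : HasValueAt (f + g) ξ (c + d) := by
  obtain ⟨F, h1, h2, h3⟩ := hf
  obtain ⟨G, k1, k2, k3⟩ := hg
  exact ⟨F + G, h1.add k1, (Lp.coeFn_add f g).trans (h2.add k2), by simp [h3, k3]⟩

theorem HasValueAt.smul {f : L2} {ξ : ℝ} {c : ℂ} (d : ℂ) (hf : HasValueAt f ξ c) :
    HasValueAt (d • f) ξ (d • c) := by
  obtain ⟨F, h1, h2, h3⟩ := hf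
  exact ⟨d • F, h1.const_smul d, (Lp.coeFn_smul d f).trans (h2.const_smul d), by simp [h3]⟩

theorem isWeakDeriv_zero : IsWeakDeriv 0 0 := by
  have h : ∀ ζ : ℝ → ℝ, ∫ ξ in Ioo (0 : ℝ) 1, ζ ξ • (0 : L2) ξ = 0 := fun ζ =>
    integral_eq_zero_of_ae (by
      filter_upwards [Lp.coeFn_zero ℂ 2 (volume.restrict (Ioo (0 : ℝ) 1))] with ξ hξ
      rw [hξ, Pi.zero_apply, smul_zero])
  intro η _ _ _
  rw [h, h, neg_zero]

theorem hasValueAt_zero (ξ : ℝ) : HasValueAt 0 ξ 0 :=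
  ⟨0, continuousOn_const, Lp.coeFn_zero _ _ _, rfl⟩

/-- Uniqueness of the weak derivative (of the zero function). -/
theorem IsWeakDeriv.eq_zero {g : L2} (h : IsWeakDeriv 0 g) : g = 0 := by
  have hg : LocallyIntegrableOn g (Ioo (0 : ℝ) 1) :=
    IntegrableOn.locallyIntegrableOn ((Lp.memLp g).integrable (by norm_num))
  have key := isOpen_Ioo.ae_eq_zero_of_integral_contDiff_smul_eq_zero hg (fun η h1 h2 h3 => by
    have e0 : ∫ ξ in Ioo (0 : ℝ) 1, deriv η ξ • (0 : L2) ξ = 0 :=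
      integral_eq_zero_of_ae (by
        filter_upwards [Lp.coeFn_zero ℂ 2 (volume.restrict (Ioo (0 : ℝ) 1))] with ξ hξ
        rw [hξ, Pi.zero_apply, smul_zero])
    have e1 := h η h1 h2 h3
    rw [e0] at e1
    have e2 : ∫ ξ in Ioo (0 : ℝ) 1, η ξ • g ξ = 0 := neg_eq_zero.mp e1.symm
    rw [← e2, setIntegral_eq_integral_of_forall_compl_eq_zero]
    intro ξ hξ
    have : η ξ = 0 := image_eq_zero_of_notMem_tsupport (fun hh => hξ (h3 hh))
    simp [this])
  rw [Lp.eq_zero_iff_ae_eq_zero]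
  exact (ae_restrict_iff' measurableSet_Ioo).2 key

/-- The graph of the Dirichlet operator `A f = a f''` on
`D(A) = {f ∈ H²(0,1) | f(0) = f(1) = 0}`. -/
def dirichletGraph (a : ℝ) : Submodule ℂ (L2 × L2) where
  carrier := {p | ∃ f'' : L2, HasSecondWeakDeriv p.1 f'' ∧ HasValueAt p.1 0 0 ∧
    HasValueAt p.1 1 0 ∧ p.2 = (a : ℂ) • f''}
  zero_mem' := ⟨0, ⟨0, isWeakDeriv_zero, isWeakDeriv_zero⟩, hasValueAt_zero 0,
    hasValueAt_zero 1, by simp⟩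
  add_mem' := by
    rintro p q ⟨f, ⟨f', h1, h2⟩, h3, h4, h5⟩ ⟨g, ⟨g', k1, k2⟩, k3, k4, k5⟩
    exact ⟨f + g, ⟨f' + g', h1.add k1, h2.add k2⟩, by simpa using h3.add k3,
      by simpa using h4.add k4, by simp [h5, k5]⟩
  smul_mem' := by
    rintro c p ⟨f, ⟨f', h1, h2⟩, h3, h4, h5⟩
    exact ⟨c • f, ⟨c • f', h1.smul c, h2.smul c⟩, by simpa using h3.smul c,
      by simpa using h4.smul c, by simp [h5, smul_comm]⟩

/-- The Dirichlet operator `A f = a f''`, `D(A) = {f ∈ H²(0,1) | f(0) = f(1) = 0}`,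
on `L²(0,1)`. -/
def dirichletOp (a : ℝ) : L2 →ₗ.[ℂ] L2 := (dirichletGraph a).toLinearPMap

theorem mem_graph_dirichletOp (a : ℝ) (f g : L2) :
    (f, g) ∈ (dirichletOp a).graph ↔
      ∃ f'' : L2, HasSecondWeakDeriv f f'' ∧ HasValueAt f 0 0 ∧ HasValueAt f 1 0 ∧
        g = (a : ℂ) • f'' := by
  rw [dirichletOp, Submodule.toLinearPMap_graph_eq]
  · rfl
  · rintro ⟨x, y⟩ ⟨f, ⟨f', h1, h2⟩, -, -, h5⟩ hx
    simp only at hx h1 h5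
    subst hx
    have := h1.eq_zero
    subst this
    rw [h5, h2.eq_zero, smul_zero]

/-- The inverse `A⁻¹ = -(0 · I - A)⁻¹` of the Dirichlet operator. -/
def dirichletInv (a : ℝ) : L2 →L[ℂ] L2 := -resolventOp (dirichletOp a) 0

/-- The extrapolation space `X₋₁` of the Dirichlet operator, with norm `‖x‖₋₁ = ‖A⁻¹ x‖`. -/
abbrev HeatXm1 (a : ℝ) : Type := Extrapolation (dirichletOp a) 0

/-- `B` is the input operator of the boundary control system `x_t = a x_ξξ`, `x(0,t) = 0`,
`x(1,t) = u(t)`. With `Z = {z ∈ H²(0,1) | z(0) = 0}`, `L z = a z''` and `G z = z(1)` for `z ∈ Z`,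
this means `L z = A₋₁ z + B G z` in `X₋₁` for all `z ∈ Z`, where `A₋₁` is the generator of the
extension of the semigroup `T` to `X₋₁`. -/
def IsBoundaryInputOp (a : ℝ) (T : ℝ → L2 →L[ℂ] L2) (B : ℂ →L[ℂ] HeatXm1 a) : Prop :=
  ∀ (z z'' : L2) (c : ℂ), HasSecondWeakDeriv z z'' → HasValueAt z 0 0 → HasValueAt z 1 c →
    GeneratorMapsTo (fun t => extend (dirichletOp a) 0 (T t)) (emb (dirichletOp a) 0 z)
      (emb (dirichletOp a) 0 ((a : ℂ) • z'') - B c)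

/-- `V(x) = -⟨A⁻¹ x, x⟩` (with `⟨f, g⟩ = ∫ f conj(g)`, i.e. `⟨f, g⟩ = inner ℂ g f`; the real part is taken to obtain a real-valued function). -/
def heatV (a : ℝ) (x : L2) : ℝ := (-inner ℂ x (dirichletInv a x)).re

end HeatISS

end

noncomputable section

namespace HeatISS

/-! ### Diagonal operators with respect to a Hilbert basis -/

section Diagonal

variable {X : Type*} [NormedAddCommGroup X] [InnerProductSpace ℂ X] (e : HilbertBasis ℕ ℂ X)

/-! In the orthonormal basis `√2 sin((n + 1)πξ)` the Dirichlet operator is multiplication by `-λₙ`,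
with `λₙ = a((n + 1)π)² ≥ a > 0`. The theorem thus reduces to a statement about diagonal operators
whose eigenvalues stay away from zero. Put `R = (-A)⁻¹`, which is bounded, symmetric and positive.

The boundary value enters through the lift `b(ξ) = ξ`. Since `b'' = 0`, `b(0) = 0` and `b(1) = 1`,
the function `z - z(1) b` lies in `D(A)` and `A` maps it to `a z''`; hence `B = -A₋₁ b`. The
extended `R` identifies `X₋₁` isometrically with `X`, intertwines the two semigroups and sends `B c`
to `c b`, so identities in `X₋₁` become identities in `X`.

The forced response has coefficients `λₙ ∫₀ᵗ exp(-λₙ(t - s)) u(s) ds · bₙ`. The kernel `λₙ exp(-λₙ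
s)` has mass at most one, so they are dominated by `‖u‖ |bₙ|` uniformly in `t` (`norm_expConv_le`).
This gives values in `X`, continuity in time by dominated convergence, and directly the ISS estimate
`exp(-δt)‖x‖ + ‖b‖‖u‖`.

For `V(x) = Re ⟨x, R x⟩`, symmetry gives `V(p) - V(x) = Re ⟨p + x, R(p - x)⟩`. For `p = φ(t, x, u)`,
the vector `R(p - x)` is `T(t)Rx - Rx`, whose quotient by `t` tends to `-x`, plus a term of norm at
most `‖u‖‖b‖t`. So the Dini derivative is at most `-2‖x‖² + 2‖x‖‖u‖‖b‖ ≤ -‖x‖² + ‖b‖²‖u‖²`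
(`diniDeriv_le`).

Diagonality (`isDiagonal_dirichletOp`) comes from inverting `f ↦ f''` by an explicit Green operator,
with uniqueness by du Bois-Reymond, and from completeness of the sines. The same Green operator
yields the integral formula for `V`. -/

theorem ext_repr {x y : X} (h : ∀ n, e.repr x n = e.repr y n) : x = y :=
  e.repr.injective (lp.ext (funext h))

theorem hasSum_sq_norm_repr (x : X) : HasSum (fun n => ‖e.repr x n‖ ^ 2) (‖x‖ ^ 2) := by
  have h := lp.hasSum_norm (p := 2) (by norm_num) (e.repr x)
  simpa using h

/-- Square summability is inherited from the coefficients of `d`. This produces both diagonal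
operators, with `d` the argument, and the forced response, with `d` the boundary lift. -/
theorem exists_repr_eq (d : X) (c : ℕ → ℂ) (M : ℝ) (h : ∀ n, ‖c n‖ ≤ M * ‖e.repr d n‖) :
    ∃ y : X, ∀ n, e.repr y n = c n := by
  have hc : Memℓp c 2 := by
    refine Memℓp.mono (g := fun n => M * ‖e.repr d n‖) ?_ h
    exact ((lp.memℓp (e.repr d)).norm).const_mul M
  exact ⟨e.repr.symm ⟨c, hc⟩, fun n => by simp⟩

theorem norm_le_of_repr {x y : X} {M : ℝ} (hM : 0 ≤ M)
    (h : ∀ n, ‖e.repr y n‖ ≤ M * ‖e.repr x n‖) : ‖y‖ ≤ M * ‖x‖ := by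
  refine le_of_sq_le_sq ?_ (by positivity)
  rw [mul_pow]
  refine hasSum_le (fun n => ?_) (hasSum_sq_norm_repr e y)
    ((hasSum_sq_norm_repr e x).mul_left (M ^ 2))
  rw [← mul_pow]
  exact pow_le_pow_left₀ (norm_nonneg _) (h n) 2

/-- Dominated convergence for the coefficients with respect to a Hilbert basis. -/
theorem tendsto_of_repr {ι : Type*} {l : Filter ι} {y : ι → X} {x : X} (d : X)
    (hd : ∀ᶠ i in l, ∀ n, ‖e.repr (y i) n - e.repr x n‖ ≤ ‖e.repr d n‖)
    (h : ∀ n, Tendsto (fun i => e.repr (y i) n) l (𝓝 (e.repr x n))) :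
    Tendsto y l (𝓝 x) := by
  rw [tendsto_iff_norm_sub_tendsto_zero]
  have key : Tendsto (fun i => ∑' n, ‖e.repr (y i) n - e.repr x n‖ ^ 2) l
      (𝓝 (∑' _ : ℕ, (0 : ℝ))) := by
    refine tendsto_tsum_of_dominated_convergence (hasSum_sq_norm_repr e d).summable
      (fun n => ?_) ?_
    · have := ((tendsto_iff_norm_sub_tendsto_zero.1 (h n)).pow 2)
      simpa using this
    · filter_upwards [hd] with i hi n
      rw [Real.norm_of_nonneg (by positivity)]
      exact pow_le_pow_left₀ (norm_nonneg _) (hi n) 2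
  have e1 : ∀ i, ∑' n, ‖e.repr (y i) n - e.repr x n‖ ^ 2 = ‖y i - x‖ ^ 2 := fun i => by
    rw [← (hasSum_sq_norm_repr e (y i - x)).tsum_eq]
    simp
  simp only [e1, tsum_zero] at key
  have := key.sqrt
  simpa using this

/-- The operator that multiplies the `n`-th coefficient by `c n`. -/
def diag (c : ℕ → ℝ) (hc : ∃ M : ℝ, ∀ n, |c n| ≤ M) : X →L[ℂ] X :=
  have key : ∀ x : X, ∃ y : X, ∀ n, e.repr y n = (c n : ℂ) * e.repr x n := fun x =>
    exists_repr_eq e x _ hc.choose fun n => by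
      rw [norm_mul, Complex.norm_real, Real.norm_eq_abs]
      exact mul_le_mul_of_nonneg_right (hc.choose_spec n) (norm_nonneg _)
  LinearMap.mkContinuous
    { toFun := fun x => (key x).choose
      map_add' := fun x y => ext_repr e fun n => ((key (x + y)).choose_spec n).trans <| by
        rw [map_add, map_add, lp.coeFn_add, lp.coeFn_add, Pi.add_apply, Pi.add_apply,
          (key x).choose_spec n, (key y).choose_spec n, mul_add]
      map_smul' := fun r x => ext_repr e fun n => ((key (r • x)).choose_spec n).trans <| by
        rw [map_smul, map_smul, lp.coeFn_smul, lp.coeFn_smul, Pi.smul_apply, Pi.smul_apply,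
          RingHom.id_apply, (key x).choose_spec n, smul_eq_mul, smul_eq_mul, mul_left_comm] } hc.choose
    fun x => norm_le_of_repr e ((abs_nonneg _).trans (hc.choose_spec 0)) fun n => by
      change ‖e.repr (key x).choose n‖ ≤ _
      rw [(key x).choose_spec, norm_mul, Complex.norm_real, Real.norm_eq_abs]
      exact mul_le_mul_of_nonneg_right (hc.choose_spec n) (norm_nonneg _)

@[simp] theorem repr_diag (c : ℕ → ℝ) (hc : ∃ M : ℝ, ∀ n, |c n| ≤ M) (x : X) (n : ℕ) :
    e.repr (diag e c hc x) n = (c n : ℂ) * e.repr x n := by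
  -- By proof irrelevance, the vector chosen from this existence statement is the one chosen in
  -- `diag`.
  have key : ∀ x : X, ∃ y : X, ∀ n, e.repr y n = (c n : ℂ) * e.repr x n := fun x =>
    exists_repr_eq e x _ hc.choose fun n => by
      rw [norm_mul, Complex.norm_real, Real.norm_eq_abs]
      exact mul_le_mul_of_nonneg_right (hc.choose_spec n) (norm_nonneg _)
  exact (key x).choose_spec n

theorem norm_diag_apply_le (c : ℕ → ℝ) (hc : ∃ M : ℝ, ∀ n, |c n| ≤ M) {M : ℝ}
    (hM : ∀ n, |c n| ≤ M) (x : X) : ‖diag e c hc x‖ ≤ M * ‖x‖ :=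
  norm_le_of_repr e ((abs_nonneg _).trans (hM 0)) fun n => by
    rw [repr_diag, norm_mul, Complex.norm_real, Real.norm_eq_abs]
    exact mul_le_mul_of_nonneg_right (hM n) (norm_nonneg _)

theorem diag_comm (c d : ℕ → ℝ) (hc : ∃ M : ℝ, ∀ n, |c n| ≤ M) (hd : ∃ M : ℝ, ∀ n, |d n| ≤ M)
    (x : X) : diag e c hc (diag e d hd x) = diag e d hd (diag e c hc x) :=
  ext_repr e fun n => by simp [mul_left_comm]

theorem hasSum_inner_diag (c : ℕ → ℝ) (hc : ∃ M : ℝ, ∀ n, |c n| ≤ M) (x y : X) :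
    HasSum (fun n => (c n : ℂ) * (conj (e.repr x n) * e.repr y n))
      (inner ℂ x (diag e c hc y)) := by
  have h := lp.hasSum_inner (𝕜 := ℂ) (e.repr x) (e.repr (diag e c hc y))
  rw [e.repr.inner_map_map] at h
  convert! h using 2 with n
  simp only [repr_diag, RCLike.inner_apply]
  ring

theorem diag_symmetric (c : ℕ → ℝ) (hc : ∃ M : ℝ, ∀ n, |c n| ≤ M) (x y : X) :
    inner ℂ (diag e c hc x) y =
      inner ℂ x (diag e c hc y) := by
  have h1 := (Complex.hasSum_conj'.2 (hasSum_inner_diag e c hc y x))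
  have h2 := hasSum_inner_diag e c hc x y
  rw [← inner_conj_symm (diag e c hc x) y]
  refine h1.unique ?_
  convert! h2 using 2 with n
  simp [mul_comm]

theorem inner_diag_self (c : ℕ → ℝ) (hc : ∃ M : ℝ, ∀ n, |c n| ≤ M) (x : X) :
    HasSum (fun n => c n * ‖e.repr x n‖ ^ 2) (inner ℂ x (diag e c hc x)).re := by
  have h := Complex.hasSum_re (hasSum_inner_diag e c hc x x)
  convert! h using 2 with n
  rw [mul_comm (conj _), Complex.mul_conj, ← Complex.ofReal_mul, Complex.ofReal_re,
    Complex.normSq_eq_norm_sq]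

/-- Every term of the series is nonnegative and one is positive. The `c n` may tend to zero, so no
coercivity follows. -/
theorem inner_diag_self_pos (c : ℕ → ℝ) (hc : ∃ M : ℝ, ∀ n, |c n| ≤ M) (hpos : ∀ n, 0 < c n)
    {x : X} (hx : x ≠ 0) : 0 < (inner ℂ x (diag e c hc x)).re := by
  have h := inner_diag_self e c hc x
  obtain ⟨n, hn⟩ : ∃ n, e.repr x n ≠ 0 := by
    by_contra! hcon
    exact hx (ext_repr e fun n => by simp [hcon n])
  rw [← h.tsum_eq]
  have hp : 0 < ‖e.repr x n‖ := norm_pos_iff.2 hn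
  have := hpos n
  exact h.summable.tsum_pos (fun m => by have := hpos m; positivity) n (by positivity)

end Diagonal

/-! ### Integrals against bounded inputs -/

theorem ae_norm_le_norm {U : Type*} [NormedAddCommGroup U] (u : Input U) :
    ∀ᵐ s ∂(volume.restrict (Ici (0 : ℝ))), ‖u s‖ ≤ ‖u‖ := by
  have hfin : eLpNorm u ⊤ (volume.restrict (Ici (0 : ℝ))) ≠ ⊤ := (Lp.memLp u).2.ne
  filter_upwards [ae_le_eLpNormEssSup (f := u) (μ := volume.restrict (Ici (0 : ℝ)))] with s hs
  rw [Lp.norm_def]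
  rw [← eLpNorm_exponent_top] at hs
  simpa using ENNReal.toReal_mono hfin hs

theorem ae_norm_le_norm_Ioc {U : Type*} [NormedAddCommGroup U] (u : Input U) (t : ℝ) :
    ∀ᵐ s ∂(volume.restrict (Ioc (0 : ℝ) t)), ‖u s‖ ≤ ‖u‖ :=
  ae_mono (Measure.restrict_mono (fun _ hs => hs.1.le) le_rfl) (ae_norm_le_norm u)

theorem intervalIntegrable_input_smul {E : Type*} [NormedAddCommGroup E] [NormedSpace ℂ E]
    (u : Input ℂ) {t : ℝ} (ht : 0 ≤ t) {g : ℝ → E} (hg : ContinuousOn g (Icc 0 t)) :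
    IntervalIntegrable (fun s => u s • g s) volume 0 t := by
  rw [intervalIntegrable_iff_integrableOn_Ioc_of_le ht]
  refine (hg.integrableOn_Icc.mono_set Ioc_subset_Icc_self).bdd_smul ‖u‖ ?_
    (ae_norm_le_norm_Ioc u t)
  exact (Lp.aestronglyMeasurable u).mono_measure
    (Measure.restrict_mono (fun _ hs => hs.1.le) le_rfl)

theorem continuousOn_primitive_Ici {E : Type*} [NormedAddCommGroup E] [NormedSpace ℝ E]
    {f : ℝ → E} (h : ∀ t : ℝ, 0 ≤ t → IntervalIntegrable f volume 0 t) :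
    ContinuousOn (fun t => ∫ s in (0 : ℝ)..t, f s) (Ici 0) := by
  intro t ht
  -- The interval `[0, t + 1]`, unlike `[0, t]`, is a neighbourhood of `t` within `[0, ∞)`.
  have ht' : (0 : ℝ) ≤ t + 1 := by linarith [mem_Ici.1 ht]
  have h1 : IntegrableOn f (uIcc 0 (t + 1)) := by
    rw [uIcc_of_le ht', integrableOn_Icc_iff_integrableOn_Ioc,
      ← intervalIntegrable_iff_integrableOn_Ioc_of_le ht']
    exact h _ ht'
  have h2 := intervalIntegral.continuousOn_primitive_interval h1 t
    (by rw [uIcc_of_le ht']; exact ⟨ht, by linarith⟩)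
  refine h2.mono_of_mem_nhdsWithin ?_
  rw [uIcc_of_le ht', ← Ici_inter_Iic]
  exact inter_mem self_mem_nhdsWithin (mem_nhdsWithin_of_mem_nhds (Iic_mem_nhds (by linarith)))

/-- The solution `∫₀ᵗ e^{-l (t - s)} u(s) ds` of `c' = -l c + u`, `c(0) = 0`. -/
def expConv (l t : ℝ) (u : Input ℂ) : ℂ :=
  ∫ s in (0 : ℝ)..t, u s • (Real.exp (-(l * (t - s))) : ℂ)

theorem intervalIntegrable_expConv (l t r : ℝ) (ht : 0 ≤ t) (u : Input ℂ) :
    IntervalIntegrable (fun s => u s • (Real.exp (-(l * (r - s))) : ℂ)) volume 0 t :=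
  intervalIntegrable_input_smul u ht (Continuous.continuousOn (by fun_prop))

theorem expConv_congr {l t : ℝ} (ht : 0 ≤ t) {u v : Input ℂ}
    (h : ∀ᵐ s ∂(volume.restrict (Icc (0 : ℝ) t)), u s = v s) : expConv l t u = expConv l t v := by
  have h' := ae_mono (Measure.restrict_mono (Ioc_subset_Icc_self (a := 0) (b := t)) le_rfl) h
  unfold expConv
  rw [intervalIntegral.integral_of_le ht, intervalIntegral.integral_of_le ht]
  refine integral_congr_ae ?_
  filter_upwards [h'] with s hs
  rw [hs]

/-- The kernel `l * exp(-l(t - s))` has mass `1 - exp(-lt) ≤ 1` on `[0, t]`. The bound is uniform in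
`l`, which compensates the unboundedness of the input operator. -/
theorem norm_expConv_le {l t : ℝ} (ht : 0 ≤ t) (hl : 0 < l) (u : Input ℂ) :
    l * ‖expConv l t u‖ ≤ ‖u‖ := by
  have h1 : ‖expConv l t u‖ ≤ ∫ s in (0 : ℝ)..t, ‖u‖ * Real.exp (-(l * (t - s))) := by
    refine intervalIntegral.norm_integral_le_of_norm_le ht ?_
      (Continuous.intervalIntegrable (by fun_prop) _ _)
    rw [← ae_restrict_iff' measurableSet_Ioc]
    filter_upwards [ae_norm_le_norm_Ioc u t] with s hs
    rw [norm_smul, Complex.norm_real, Real.norm_of_nonneg (Real.exp_pos _).le]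
    exact mul_le_mul_of_nonneg_right hs (Real.exp_pos _).le
  have h2 : ∫ s in (0 : ℝ)..t, ‖u‖ * Real.exp (-(l * (t - s)))
      = ‖u‖ * (1 / l) - ‖u‖ * (Real.exp (-(l * t)) / l) := by
    rw [intervalIntegral.integral_eq_sub_of_hasDerivAt
      (f := fun s => ‖u‖ * (Real.exp (-(l * (t - s))) / l))
      (fun s _ => ?_) (Continuous.intervalIntegrable (by fun_prop) _ _)]
    · simp
    · have h3 : HasDerivAt (fun s => -(l * (t - s))) l s := by
        have := (((hasDerivAt_id s).const_sub t).const_mul l).fun_neg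
        simpa using this
      have := (h3.exp.div_const l).const_mul ‖u‖
      simpa [hl.ne'] using this
  have h4 : 0 ≤ ‖u‖ * (Real.exp (-(l * t)) / l) := by positivity
  calc l * ‖expConv l t u‖ ≤ l * (‖u‖ * (1 / l)) := by
        refine mul_le_mul_of_nonneg_left ?_ hl.le
        linarith
    _ = ‖u‖ := by field_simp

/-- With the factor `exp(-lt)` taken out, the integrand no longer depends on `t`, and continuity in
`t` becomes that of a primitive. -/
theorem expConv_eq (l t : ℝ) (u : Input ℂ) :
    expConv l t u = (Real.exp (-(l * t)) : ℂ) * ∫ s in (0 : ℝ)..t, u s • (Real.exp (l * s) : ℂ) := by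
  unfold expConv
  rw [← intervalIntegral.integral_const_mul]
  congr 1 with s
  rw [show -(l * (t - s)) = -(l * t) + l * s by ring, Real.exp_add]
  push_cast
  simp only [smul_eq_mul]
  ring

theorem continuousOn_expConv (l : ℝ) (u : Input ℂ) :
    ContinuousOn (fun t => expConv l t u) (Ici 0) := by
  simp only [expConv_eq]
  refine ContinuousOn.mul (Continuous.continuousOn (by fun_prop)) ?_
  exact continuousOn_primitive_Ici fun t ht =>
    intervalIntegrable_input_smul u ht (Continuous.continuousOn (by fun_prop))

theorem expConv_zero (l : ℝ) (u : Input ℂ) : expConv l 0 u = 0 := by simp [expConv]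

/-- Split the integral at `t` and translate the second piece; this is the cocycle property of one
coefficient. -/
theorem expConv_add (l : ℝ) {t h : ℝ} (ht : 0 ≤ t) (hh : 0 ≤ h) (u : Input ℂ) :
    expConv l (t + h) u =
      (Real.exp (-(l * h)) : ℂ) * expConv l t u + expConv l h (shift t ht u) := by
  have e1 : expConv l h (shift t ht u)
      = ∫ s in t..(t + h), u s • (Real.exp (-(l * (t + h - s))) : ℂ) := by
    have h1 : ∫ s in t..(t + h), u s • (Real.exp (-(l * (t + h - s))) : ℂ)
        = ∫ s in (0 : ℝ)..h, u (t + s) • (Real.exp (-(l * (h - s))) : ℂ) := by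
      have := intervalIntegral.integral_comp_add_left (a := 0) (b := h)
        (fun s => u s • (Real.exp (-(l * (t + h - s))) : ℂ)) t
      rw [add_zero] at this
      rw [← this]
      congr 1 with s
      rw [show t + h - (t + s) = h - s by ring]
    rw [h1]
    unfold expConv
    rw [intervalIntegral.integral_of_le hh, intervalIntegral.integral_of_le hh]
    refine integral_congr_ae ?_
    have h2 := (memLp_shift t ht u).coeFn_toLp
    have h3 := ae_mono (Measure.restrict_mono (s := Ioc 0 h) (s' := Ici 0)
      (fun _ hs => hs.1.le) le_rfl) h2
    filter_upwards [h3] with s hs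
    simp only [shift, hs]
  have e2 : (Real.exp (-(l * h)) : ℂ) * expConv l t u
      = ∫ s in (0 : ℝ)..t, u s • (Real.exp (-(l * (t + h - s))) : ℂ) := by
    unfold expConv
    rw [← intervalIntegral.integral_const_mul]
    congr 1 with s
    rw [show -(l * (t + h - s)) = -(l * h) + -(l * (t - s)) by ring, Real.exp_add]
    push_cast
    simp only [smul_eq_mul]
    ring
  rw [e1, e2]
  have i1 := intervalIntegrable_expConv l t (t + h) ht u
  have i2 := intervalIntegrable_expConv l (t + h) (t + h) (add_nonneg ht hh) u
  exact (intervalIntegral.integral_add_adjacent_intervals i1 (i1.symm.trans i2)).symm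

/-! ### Isometric identification of the extrapolation space -/

section Extrapolation

variable {X : Type*} [NormedAddCommGroup X] [NormedSpace ℂ X]
  (A : X →ₗ.[ℂ] X) (β : ℂ)

theorem induction_emb (p : Extrapolation A β → Prop) (y : Extrapolation A β)
    (hp : IsClosed {y | p y}) (h : ∀ x : X, p (emb A β x)) : p y :=
  UniformSpace.Completion.induction_on y hp h

variable [CompleteSpace X]

/-- The extension of the resolvent to the extrapolation space. -/
def extResolvent : Extrapolation A β →L[ℂ] X :=
  ContinuousLinearMap.extend ((preResolvent A β).mkContinuous 1 fun x => by
    rw [one_mul]; rfl) (UniformSpace.Completion.toComplL)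

theorem extResolvent_emb (x : X) : extResolvent A β (emb A β x) = resolventOp A β x :=
  ContinuousLinearMap.extend_eq _ UniformSpace.Completion.denseRange_coe
    (UniformSpace.Completion.isUniformInducing_coe _) _

theorem norm_extResolvent (y : Extrapolation A β) : ‖extResolvent A β y‖ = ‖y‖ := by
  refine induction_emb A β (fun y => ‖extResolvent A β y‖ = ‖y‖) y
    (isClosed_eq (by fun_prop) (by fun_prop)) fun x => ?_
  rw [extResolvent_emb, norm_emb]

/-- If the resolvent has dense range, its extension identifies the extrapolation space
with `X`. -/
def extResolventEquiv (h : DenseRange (resolventOp A β)) : Extrapolation A β ≃ₗᵢ[ℂ] X :=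
  LinearIsometryEquiv.ofSurjective ⟨(extResolvent A β).toLinearMap, norm_extResolvent A β⟩ <| by
    -- The range of an isometry on a complete space is closed, and this one contains the dense range
    -- of the resolvent.
    have hiso : Isometry (extResolvent A β) :=
      AddMonoidHomClass.isometry_of_norm _ (norm_extResolvent A β)
    have hcl : IsClosed (range (extResolvent A β)) := hiso.isClosedEmbedding.isClosed_range
    have hd : Dense (range (extResolvent A β)) := by
      refine h.mono ?_
      rintro _ ⟨x, rfl⟩
      exact ⟨emb A β x, extResolvent_emb A β x⟩
    intro x
    have : x ∈ range (extResolvent A β) := by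
      rw [← hcl.closure_eq, hd.closure_eq]; trivial
    exact this

variable {A β} (h : DenseRange (resolventOp A β))

@[simp] theorem extResolventEquiv_emb (x : X) :
    extResolventEquiv A β h (emb A β x) = resolventOp A β x :=
  extResolvent_emb A β x

/-- Both sides are continuous in `y` and agree on the dense image of `X`. The identification with
`X` therefore carries the extension of `S` back to `S` itself. -/
theorem extResolventEquiv_extend {S : X →L[ℂ] X}
    (hS : ∀ x, resolventOp A β (S x) = S (resolventOp A β x)) (y : Extrapolation A β) :
    extResolventEquiv A β h (extend A β S y) = S (extResolventEquiv A β h y) := by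
  refine induction_emb A β (fun y => extResolventEquiv A β h (extend A β S y) =
    S (extResolventEquiv A β h y)) y (isClosed_eq ?_ ?_) fun x => ?_
  · exact (extResolventEquiv A β h).continuous.comp UniformSpace.Completion.continuous_map
  · exact S.continuous.comp (extResolventEquiv A β h).continuous
  · rw [extend_emb A β S hS]
    simp [hS]

end Extrapolation

/-! ### Systems with a diagonal generator -/

/-- `A` is the maximal diagonal operator with eigenvalues `-lam n`, bounded away from zero, with
respect to the Hilbert basis `e`. -/
structure IsDiagonal {X : Type*} [NormedAddCommGroup X] [InnerProductSpace ℂ X]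
    (A : X →ₗ.[ℂ] X) (e : HilbertBasis ℕ ℂ X) (lam : ℕ → ℝ) : Prop where
  exists_le : ∃ δ : ℝ, 0 < δ ∧ ∀ n, δ ≤ lam n
  mem_graph_iff : ∀ x y : X, (x, y) ∈ A.graph ↔ ∀ n, e.repr y n = -(lam n : ℂ) * e.repr x n

namespace IsDiagonal

variable {X : Type*} [NormedAddCommGroup X] [InnerProductSpace ℂ X]
  {A : X →ₗ.[ℂ] X} {e : HilbertBasis ℕ ℂ X} {lam : ℕ → ℝ} (hA : IsDiagonal A e lam)

include hA

theorem pos (n : ℕ) : 0 < lam n := by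
  obtain ⟨δ, h, h'⟩ := hA.exists_le
  exact h.trans_le (h' n)

theorem bdd_inv : ∃ M : ℝ, ∀ n, |(lam n)⁻¹| ≤ M := by
  obtain ⟨δ, h, h'⟩ := hA.exists_le
  refine ⟨δ⁻¹, fun n => ?_⟩
  rw [abs_of_pos (inv_pos.2 (hA.pos n))]
  exact inv_anti₀ h (h' n)

theorem isResolventOp : IsResolventOp A 0 (diag e (fun n => (lam n)⁻¹) hA.bdd_inv) := by
  have hne : ∀ n, (lam n : ℂ) ≠ 0 := fun n => by exact_mod_cast (hA.pos n).ne'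
  constructor
  · intro x
    -- At `β = 0` the resolvent is `-A⁻¹`, hence the sign in `-x`.
    have hg : (diag e (fun n => (lam n)⁻¹) hA.bdd_inv x, -x) ∈ A.graph := by
      rw [hA.mem_graph_iff]
      intro n
      have := hne n
      simp [this]
    obtain ⟨z, hz, hz'⟩ := (LinearPMap.mem_graph_iff A).1 hg
    simp only at hz hz'
    refine ⟨hz ▸ z.2, ?_⟩
    have : (⟨_, hz ▸ z.2⟩ : A.domain) = z := Subtype.ext hz.symm
    rw [this, hz']
    simp
  · intro x
    refine ext_repr e fun n => ?_
    have h := (hA.mem_graph_iff _ _).1 (A.mem_graph x) n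
    have := hne n
    simp [h, this]

theorem resolventOp_eq : resolventOp A 0 = diag e (fun n => (lam n)⁻¹) hA.bdd_inv := by
  have hex : InResolventSet A 0 := ⟨_, hA.isResolventOp⟩
  rw [resolventOp, dif_pos hex]
  exact hex.choose_spec.unique hA.isResolventOp

theorem repr_resolventOp (x : X) (n : ℕ) :
    e.repr (resolventOp A 0 x) n = (lam n : ℂ)⁻¹ * e.repr x n := by
  rw [hA.resolventOp_eq, repr_diag, Complex.ofReal_inv]

/-- Each basis vector `e n` is the image of `lam n • e n`. -/
theorem denseRange_resolventOp : DenseRange (resolventOp A 0) := by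
  have h : Submodule.span ℂ (range e) ≤ LinearMap.range (resolventOp A 0 : X →ₗ[ℂ] X) := by
    rw [Submodule.span_le]
    rintro _ ⟨n, rfl⟩
    refine ⟨(lam n : ℂ) • e n, ext_repr e fun m => ?_⟩
    have hne : (lam n : ℂ) ≠ 0 := by exact_mod_cast (hA.pos n).ne'
    rw [ContinuousLinearMap.coe_coe, hA.repr_resolventOp, map_smul, e.repr_self, lp.coeFn_smul,
      Pi.smul_apply]
    by_cases hmn : m = n
    · subst hmn; simp [hne]
    · simp [hmn]
  have hd : Dense ((Submodule.span ℂ (range e) : Submodule ℂ X) : Set X) := by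
    rw [Submodule.dense_iff_topologicalClosure_eq_top]
    exact e.dense_span
  exact hd.mono h

theorem bdd_exp (t : ℝ) : ∀ n, |Real.exp (-(lam n * max t 0))| ≤ 1 := fun n => by
  rw [abs_of_pos (Real.exp_pos _), Real.exp_le_one_iff]
  have := hA.pos n
  have : 0 ≤ lam n * max t 0 := by positivity
  linarith

/-- The semigroup generated by a diagonal operator (extended by the identity to negative
times). -/
def semigroup (t : ℝ) : X →L[ℂ] X :=
  diag e (fun n => Real.exp (-(lam n * max t 0))) ⟨1, hA.bdd_exp t⟩

theorem repr_semigroup {t : ℝ} (ht : 0 ≤ t) (x : X) (n : ℕ) :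
    e.repr (hA.semigroup t x) n = (Real.exp (-(lam n * t)) : ℂ) * e.repr x n := by
  rw [semigroup, repr_diag, max_eq_left ht]

theorem norm_semigroup_apply_le (t : ℝ) (x : X) : ‖hA.semigroup t x‖ ≤ ‖x‖ := by
  have := norm_diag_apply_le e _ ⟨1, hA.bdd_exp t⟩ (hA.bdd_exp t) x
  rwa [one_mul] at this

theorem norm_semigroup_apply_le_exp {δ : ℝ} (hδ : ∀ n, δ ≤ lam n) {t : ℝ} (ht : 0 ≤ t) (x : X) :
    ‖hA.semigroup t x‖ ≤ Real.exp (-(δ * t)) * ‖x‖ := by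
  refine norm_diag_apply_le e _ ⟨1, hA.bdd_exp t⟩ (fun n => ?_) x
  rw [abs_of_pos (Real.exp_pos _), max_eq_left ht]
  exact Real.exp_le_exp.2 (neg_le_neg (mul_le_mul_of_nonneg_right (hδ n) ht))

theorem resolventOp_semigroup (t : ℝ) (x : X) :
    resolventOp A 0 (hA.semigroup t x) = hA.semigroup t (resolventOp A 0 x) := by
  rw [hA.resolventOp_eq]
  exact diag_comm e _ _ _ _ x

theorem isC0Semigroup : IsC0Semigroup hA.semigroup where
  map_zero := by
    ext x
    refine ext_repr e fun n => ?_
    simp [hA.repr_semigroup le_rfl]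
  map_add s t hs ht := by
    ext x
    refine ext_repr e fun n => ?_
    rw [ContinuousLinearMap.comp_apply, hA.repr_semigroup (add_nonneg hs ht),
      hA.repr_semigroup hs, hA.repr_semigroup ht, ← mul_assoc, ← Complex.ofReal_mul,
      ← Real.exp_add]
    congr 3
    ring
  continuousOn x := by
    refine Continuous.continuousOn (continuous_iff_continuousAt.2 fun t => ?_)
    -- The multipliers are at most one in absolute value, so their differences are at most two and
    -- `2 • x` dominates.
    refine tendsto_of_repr e ((2 : ℂ) • x) (Eventually.of_forall fun s n => ?_) fun n => ?_
    · simp only [semigroup, repr_diag]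
      rw [← sub_mul, norm_mul, map_smul,
        lp.coeFn_smul, Pi.smul_apply, norm_smul, ← Complex.ofReal_sub, Complex.norm_real]
      refine mul_le_mul_of_nonneg_right ((norm_sub_le _ _).trans ?_) (norm_nonneg _)
      have h1 := hA.bdd_exp s n
      have h2 := hA.bdd_exp t n
      simp only [Real.norm_eq_abs, Complex.norm_ofNat]
      linarith
    · simp only [semigroup, repr_diag]
      exact (Continuous.tendsto (by fun_prop) t)

/-- The difference quotients of `T(t) R x` converge to `-x`. -/
theorem tendsto_resolventOp (x : X) :
    Tendsto (fun h : ℝ => ((1 / h : ℝ) : ℂ) • (hA.semigroup h (resolventOp A 0 x)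
      - resolventOp A 0 x)) (𝓝[>] 0) (𝓝 (-x)) := by
  have hexp : ∀ h : ℝ, 0 < h → ∀ n, e.repr (((1 / h : ℝ) : ℂ) • (hA.semigroup h
      (resolventOp A 0 x) - resolventOp A 0 x)) n
      = (((Real.exp (-(lam n * h)) - 1) / h * (lam n)⁻¹ : ℝ) : ℂ) * e.repr x n := by
    intro h hh n
    rw [map_smul, map_sub, lp.coeFn_smul, lp.coeFn_sub, Pi.smul_apply, Pi.sub_apply,
      hA.repr_semigroup hh.le, hA.repr_resolventOp]
    push_cast
    rw [smul_eq_mul]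
    ring
  -- From `1 - y ≤ exp(-y) ≤ 1` with `y = lam n * h`, the multiplier of the quotient lies in `[-1,
  -- 0]`, within distance one of its limit `-1`; so `x` dominates.
  refine tendsto_of_repr e x ?_ fun n => ?_
  · filter_upwards [self_mem_nhdsWithin] with h hh n
    replace hh : 0 < h := hh
    have hl := hA.pos n
    rw [hexp h hh, map_neg, lp.coeFn_neg, Pi.neg_apply, sub_neg_eq_add, ← add_one_mul, norm_mul]
    refine mul_le_of_le_one_left (norm_nonneg _) ?_
    rw [← Complex.ofReal_one, ← Complex.ofReal_add, Complex.norm_real, Real.norm_eq_abs,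
      ← div_eq_mul_inv, div_div]
    have h1 : 1 - lam n * h ≤ Real.exp (-(lam n * h)) := by
      have := Real.add_one_le_exp (-(lam n * h)); linarith
    have h2 : Real.exp (-(lam n * h)) ≤ 1 := by
      rw [Real.exp_le_one_iff]; have : 0 < lam n * h := by positivity
      linarith
    have hp : 0 < h * lam n := by positivity
    have h3 : -1 ≤ (Real.exp (-(lam n * h)) - 1) / (h * lam n) := by
      rw [le_div_iff₀ hp]; linarith
    have h4 : (Real.exp (-(lam n * h)) - 1) / (h * lam n) ≤ 0 :=
      div_nonpos_of_nonpos_of_nonneg (by linarith) hp.le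
    rw [abs_le]
    constructor <;> linarith
  · have hd : HasDerivAt (fun h : ℝ => Real.exp (-(lam n * h))) (-lam n) 0 := by
      have := (((hasDerivAt_id (0 : ℝ)).const_mul (lam n)).fun_neg).exp
      simpa using this
    have h1 : Tendsto (fun h : ℝ => (Real.exp (-(lam n * h)) - 1) / h * (lam n)⁻¹) (𝓝[>] 0)
        (𝓝 (-1)) := by
      have := (hd.tendsto_slope_zero_right).mul_const (lam n)⁻¹
      have hl := (hA.pos n).ne'
      simp only [neg_mul, mul_inv_cancel₀ hl] at this
      refine this.congr fun h => ?_
      simp [div_eq_inv_mul]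
    have h2 := ((Complex.continuous_ofReal.tendsto _).comp h1).mul_const (e.repr x n)
    have h3 : e.repr (-x) n = ((-1 : ℝ) : ℂ) * e.repr x n := by simp
    rw [h3]
    refine h2.congr' ?_
    filter_upwards [self_mem_nhdsWithin] with h hh
    rw [hexp h hh]
    rfl

/-- The resolvent commutes with the semigroup, so applying it to the quotients of `x` gives the two
limits `R y` and `-x`, which must coincide. The converse is `tendsto_resolventOp` at `y`. -/
theorem generatorMapsTo_iff (x y : X) :
    GeneratorMapsTo (fun t => hA.semigroup t) x y ↔ x = -resolventOp A 0 y := by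
  constructor
  · intro h
    have h1 := ((resolventOp A 0).continuous.tendsto y).comp h
    have h2 := hA.tendsto_resolventOp x
    have h3 : resolventOp A 0 y = -x := by
      refine tendsto_nhds_unique h1 (h2.congr fun t => ?_)
      simp [hA.resolventOp_semigroup]
    rw [h3, neg_neg]
  · rintro rfl
    have := (hA.tendsto_resolventOp y).neg
    rw [neg_neg] at this
    refine this.congr fun t => ?_
    simp only [map_neg, ← smul_neg]
    congr 1
    abel

theorem mem_graph_iff' (x y : X) : (x, y) ∈ A.graph ↔ x = -resolventOp A 0 y := by
  rw [hA.mem_graph_iff]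
  have hne : ∀ n, (lam n : ℂ) ≠ 0 := fun n => by exact_mod_cast (hA.pos n).ne'
  constructor
  · intro h
    refine ext_repr e fun n => ?_
    have := hne n
    simp [hA.repr_resolventOp, h, this]
  · rintro rfl n
    have := hne n
    simp [hA.repr_resolventOp, this]

theorem isGenerator : IsGenerator A hA.semigroup := fun x y => by
  rw [hA.generatorMapsTo_iff, hA.mem_graph_iff']

/-! ### The forced response -/

theorem exists_forced (b : X) {t : ℝ} (ht : 0 ≤ t) (u : Input ℂ) :
    ∃ y : X, ∀ n, e.repr y n = (lam n : ℂ) * expConv (lam n) t u * e.repr b n :=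
  exists_repr_eq e b _ ‖u‖ fun n => by
    rw [norm_mul, norm_mul, Complex.norm_real, Real.norm_of_nonneg (hA.pos n).le]
    exact mul_le_mul_of_nonneg_right (norm_expConv_le ht (hA.pos n) u) (norm_nonneg _)

/-- The forced response `-A ∫₀ᵗ T(t - s) b u(s) ds`. -/
def forced (b : X) (t : ℝ) (u : Input ℂ) : X :=
  (hA.exists_forced b (le_max_right t 0) u).choose

theorem repr_forced (b : X) {t : ℝ} (ht : 0 ≤ t) (u : Input ℂ) (n : ℕ) :
    e.repr (hA.forced b t u) n = (lam n : ℂ) * expConv (lam n) t u * e.repr b n := by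
  rw [forced, (hA.exists_forced b (le_max_right t 0) u).choose_spec, max_eq_left ht]

theorem norm_repr_forced_le (b : X) {t : ℝ} (ht : 0 ≤ t) (u : Input ℂ) (n : ℕ) :
    ‖e.repr (hA.forced b t u) n‖ ≤ ‖u‖ * ‖e.repr b n‖ := by
  rw [hA.repr_forced b ht, norm_mul, norm_mul, Complex.norm_real,
    Real.norm_of_nonneg (hA.pos n).le]
  exact mul_le_mul_of_nonneg_right (norm_expConv_le ht (hA.pos n) u) (norm_nonneg _)

theorem norm_forced_le (b : X) {t : ℝ} (ht : 0 ≤ t) (u : Input ℂ) :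
    ‖hA.forced b t u‖ ≤ ‖u‖ * ‖b‖ :=
  norm_le_of_repr e (norm_nonneg u) (hA.norm_repr_forced_le b ht u)

theorem continuousOn_forced (b : X) (u : Input ℂ) :
    ContinuousOn (fun t => hA.forced b t u) (Ici 0) := by
  intro t ht
  refine tendsto_of_repr e (((2 * ‖u‖ : ℝ) : ℂ) • b) ?_ fun n => ?_
  · filter_upwards [self_mem_nhdsWithin] with s hs n
    refine (norm_sub_le _ _).trans ?_
    have h1 := hA.norm_repr_forced_le b hs u n
    have h2 := hA.norm_repr_forced_le b ht u n
    rw [map_smul, lp.coeFn_smul, Pi.smul_apply, norm_smul, Complex.norm_real,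
      Real.norm_of_nonneg (by positivity)]
    linarith
  · have h := ((continuousOn_expConv (lam n) u t ht).tendsto.const_mul
      (lam n : ℂ)).mul_const (e.repr b n)
    rw [hA.repr_forced b ht]
    refine h.congr' ?_
    filter_upwards [self_mem_nhdsWithin] with s hs
    rw [hA.repr_forced b hs]

theorem continuousOn_smul_semigroup (b : X) (t : ℝ) :
    ContinuousOn (fun s => hA.semigroup (t - s) b) (Icc 0 t) :=
  (hA.isC0Semigroup.continuousOn b).comp (Continuous.continuousOn (by fun_prop))
    fun _ hs => sub_nonneg.2 hs.2

theorem intervalIntegrable_smul_semigroup (b : X) {t : ℝ} (ht : 0 ≤ t) (u : Input ℂ) :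
    IntervalIntegrable (fun s => u s • hA.semigroup (t - s) b) volume 0 t :=
  intervalIntegrable_input_smul u ht (hA.continuousOn_smul_semigroup b t)

variable [CompleteSpace X]

/-- The resolvent cancels the factor `lam n`, leaving an integral that converges in `X`;
coefficients pass through it as continuous functionals. This is the mild solution formula seen
through the identification of `X₋₁` with `X`. -/
theorem resolventOp_forced (b : X) {t : ℝ} (ht : 0 ≤ t) (u : Input ℂ) :
    resolventOp A 0 (hA.forced b t u) = ∫ s in (0 : ℝ)..t, u s • hA.semigroup (t - s) b := by
  refine ext_repr e fun n => ?_
  have hne : (lam n : ℂ) ≠ 0 := by exact_mod_cast (hA.pos n).ne'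
  rw [hA.repr_resolventOp, hA.repr_forced b ht, e.repr_apply_apply (∫ s in (0 : ℝ)..t, _),
    ← innerSL_apply_apply ℂ (e n),
    ← (innerSL ℂ (e n)).intervalIntegral_comp_comm (hA.intervalIntegrable_smul_semigroup b ht u)]
  have h1 : ∫ s in (0 : ℝ)..t, innerSL ℂ (e n) (u s • hA.semigroup (t - s) b)
      = ∫ s in (0 : ℝ)..t, (u s • (Real.exp (-(lam n * (t - s))) : ℂ)) * e.repr b n := by
    refine intervalIntegral.integral_congr fun s hs => ?_
    rw [uIcc_of_le ht] at hs
    simp only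
    rw [innerSL_apply_apply, ← e.repr_apply_apply, map_smul, lp.coeFn_smul, Pi.smul_apply,
      hA.repr_semigroup (sub_nonneg.2 hs.2), smul_eq_mul, smul_eq_mul, mul_assoc]
  rw [h1, intervalIntegral.integral_mul_const, ← expConv, mul_assoc, ← mul_assoc,
    inv_mul_cancel₀ hne, one_mul]

/-- The factor `t`, absent from `norm_forced_le`, keeps the difference quotients of the Lyapunov
function bounded. -/
theorem norm_resolventOp_forced_le (b : X) {t : ℝ} (ht : 0 ≤ t) (u : Input ℂ) :
    ‖resolventOp A 0 (hA.forced b t u)‖ ≤ ‖u‖ * ‖b‖ * t := by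
  rw [hA.resolventOp_forced b ht, intervalIntegral.integral_of_le ht]
  have h := norm_setIntegral_le_of_norm_le_const_ae (μ := volume) (s := Ioc (0 : ℝ) t)
    (f := fun s => u s • hA.semigroup (t - s) b) (C := ‖u‖ * ‖b‖) (by simp) ?_
  · simpa [ht] using h
  · filter_upwards [ae_norm_le_norm_Ioc u t] with s hs
    rw [norm_smul]
    exact mul_le_mul hs (hA.norm_semigroup_apply_le _ _) (norm_nonneg _) (norm_nonneg _)

end IsDiagonal

/-! ### Some comparison functions -/

theorem classK_const_mul {c : ℝ} (hc : 0 < c) : ClassK (fun r => c * r) :=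
  ⟨Continuous.continuousOn (by fun_prop), fun _ _ _ _ h => mul_lt_mul_of_pos_left h hc,
    mul_zero c⟩

theorem classKInf_const_mul_sq {c : ℝ} (hc : 0 < c) : ClassKInf (fun r => c * r ^ 2) := by
  refine ⟨⟨Continuous.continuousOn (by fun_prop), fun x hx y _ h => ?_, by simp⟩, fun M => ?_⟩
  · exact mul_lt_mul_of_pos_left (pow_lt_pow_left₀ h hx two_ne_zero) hc
  -- The summand `1` gives `s ≤ (s + 1) ^ 2` for `s = (|M| + 1) / c`, where `c * s = |M| + 1`
  -- already exceeds `M`.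
  · refine ⟨(|M| + 1) / c + 1, by positivity, ?_⟩
    have h1 : |M| + 1 = c * ((|M| + 1) / c) := by field_simp
    have h2 : 0 ≤ (|M| + 1) / c := by positivity
    have h3 : c * ((|M| + 1) / c) ≤ c * ((|M| + 1) / c + 1) ^ 2 :=
      mul_le_mul_of_nonneg_left (by nlinarith) hc.le
    linarith [le_abs_self M]

theorem classKL_exp_mul {δ : ℝ} (hδ : 0 < δ) : ClassKL (fun r t => Real.exp (-(δ * t)) * r) := by
  refine ⟨fun t _ => classK_const_mul (Real.exp_pos _), fun r hr => ⟨?_, fun s _ t _ h => ?_, ?_⟩⟩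
  · exact Continuous.continuousOn (by fun_prop)
  · refine mul_lt_mul_of_pos_right (Real.exp_lt_exp.2 (neg_lt_neg ?_)) hr
    exact mul_lt_mul_of_pos_left h hδ
  · have h1 : Tendsto (fun t : ℝ => Real.exp (-(δ * t))) atTop (𝓝 0) :=
      Real.tendsto_exp_neg_atTop_nhds_zero.comp (tendsto_id.const_mul_atTop hδ)
    simpa using h1.mul_const r

namespace IsDiagonal

variable {X : Type*} [NormedAddCommGroup X] [InnerProductSpace ℂ X]
  {A : X →ₗ.[ℂ] X} {e : HilbertBasis ℕ ℂ X} {lam : ℕ → ℝ} (hA : IsDiagonal A e lam)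

include hA

/-! ### The control system -/

/-- The mild solutions of `ẋ = A x - (A b) u`. -/
def flow (b : X) (t : ℝ) (x : X) (u : Input ℂ) : X := hA.semigroup t x + hA.forced b t u

theorem repr_flow (b : X) {t : ℝ} (ht : 0 ≤ t) (x : X) (u : Input ℂ) (n : ℕ) :
    e.repr (hA.flow b t x u) n = (Real.exp (-(lam n * t)) : ℂ) * e.repr x n
      + (lam n : ℂ) * expConv (lam n) t u * e.repr b n := by
  rw [flow, map_add, lp.coeFn_add, Pi.add_apply, hA.repr_semigroup ht, hA.repr_forced b ht]

theorem continuousOn_flow (b x : X) (u : Input ℂ) :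
    ContinuousOn (fun t => hA.flow b t x u) (Ici 0) :=
  (hA.isC0Semigroup.continuousOn x).add (hA.continuousOn_forced b u)

theorem isForwardComplete (b : X) : IsForwardComplete (hA.flow b) where
  identity x u := ext_repr e fun n => by
    rw [hA.repr_flow b le_rfl, expConv_zero]
    simp
  causality t ht x u v h := ext_repr e fun n => by
    rw [hA.repr_flow b ht, hA.repr_flow b ht, expConv_congr ht h]
  continuity := hA.continuousOn_flow b
  cocycle t ht h hh x u := ext_repr e fun n => by
    rw [hA.repr_flow b hh, hA.repr_flow b ht, hA.repr_flow b (add_nonneg ht hh),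
      expConv_add _ ht hh, show -(lam n * (t + h)) = -(lam n * h) + -(lam n * t) by ring,
      Real.exp_add]
    push_cast
    ring

/-- The explicit solution gives the estimate with decay rate `δ`; the Lyapunov function plays no
role. The `1` in the gain keeps it strictly increasing even for `b = 0`. -/
theorem isISS (b : X) : IsISS (hA.flow b) := by
  obtain ⟨δ, hδ, hδ'⟩ := hA.exists_le
  refine ⟨_, _, classKL_exp_mul hδ, classK_const_mul (c := ‖b‖ + 1) (by positivity),
    fun x u t ht => ?_⟩
  refine (norm_add_le _ _).trans
    (add_le_add (hA.norm_semigroup_apply_le_exp hδ' ht x) ((hA.norm_forced_le b ht u).trans ?_))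
  nlinarith [norm_nonneg u]

/-! ### The Lyapunov inequality -/

theorem resolventOp_symmetric (x y : X) :
    inner ℂ (resolventOp A 0 x) y = inner ℂ x (resolventOp A 0 y) := by
  rw [hA.resolventOp_eq]
  exact diag_symmetric e _ _ x y

/-- By symmetry of the resolvent the cross terms have equal real parts and cancel. In this form the
resolvent acts on the increment `p - x`, where it smooths the forced part. -/
theorem re_inner_resolventOp_sub (p x : X) :
    (inner ℂ p (resolventOp A 0 p)).re - (inner ℂ x (resolventOp A 0 x)).re
      = (inner ℂ (p + x) (resolventOp A 0 (p - x))).re := by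
  have h : (inner ℂ p (resolventOp A 0 x)).re = (inner ℂ x (resolventOp A 0 p)).re := by
    rw [← hA.resolventOp_symmetric, ← inner_conj_symm, Complex.conj_re]
  rw [map_sub, inner_add_left, inner_sub_right, inner_sub_right]
  simp only [Complex.add_re, Complex.sub_re]
  linarith

theorem diniDeriv_le [CompleteSpace X] (b x : X) (u : Input ℂ) :
    diniDeriv (hA.flow b) (fun x => (inner ℂ x (resolventOp A 0 x)).re) x u
      ≤ ((-(1 * ‖x‖ ^ 2) + (‖b‖ ^ 2 + 1) * ‖u‖ ^ 2 : ℝ) : EReal) := by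
  set q : ℝ → X := fun h => ((1 / h : ℝ) : ℂ) • (hA.semigroup h (resolventOp A 0 x)
      - resolventOp A 0 x) with hq
  have hflow : Tendsto (fun t => hA.flow b t x u) (𝓝[>] 0) (𝓝 x) := by
    have := (hA.continuousOn_flow b x u) 0 self_mem_Ici
    have h2 := this.tendsto
    rw [(hA.isForwardComplete b).identity] at h2
    exact h2.mono_left (nhdsWithin_mono _ Ioi_subset_Ici_self)
  have hlim : Tendsto (fun t => (inner ℂ (hA.flow b t x u + x) (q t)).re
      + ‖hA.flow b t x u + x‖ * (‖u‖ * ‖b‖)) (𝓝[>] 0)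
      (𝓝 ((inner ℂ (x + x) (-x)).re + ‖x + x‖ * (‖u‖ * ‖b‖))) :=
    ((Complex.continuous_re.tendsto _).comp
      ((hflow.add_const x).inner (hA.tendsto_resolventOp x))).add
      ((hflow.add_const x).norm.mul_const _)
  have hle : ∀ᶠ t in 𝓝[>] (0 : ℝ), (((1 / t) * ((inner ℂ (hA.flow b t x u)
      (resolventOp A 0 (hA.flow b t x u))).re - (inner ℂ x (resolventOp A 0 x)).re) : ℝ) : EReal)
      ≤ (((inner ℂ (hA.flow b t x u + x) (q t)).re
        + ‖hA.flow b t x u + x‖ * (‖u‖ * ‖b‖) : ℝ) : EReal) := by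
    filter_upwards [self_mem_nhdsWithin] with t ht
    replace ht : 0 < t := ht
    rw [EReal.coe_le_coe_iff, hA.re_inner_resolventOp_sub]
    -- The free part of the increment, divided by `t`, is `q t`; the forced part is bounded by `‖u‖
    -- * ‖b‖ * t`.
    have e1 : resolventOp A 0 (hA.flow b t x u - x) = (hA.semigroup t (resolventOp A 0 x)
        - resolventOp A 0 x) + resolventOp A 0 (hA.forced b t u) := by
      rw [flow, map_sub, map_add, hA.resolventOp_semigroup]
      abel
    rw [e1, inner_add_right, Complex.add_re, mul_add]
    refine add_le_add (le_of_eq ?_) ?_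
    · rw [hq]
      simp only
      rw [inner_smul_right, Complex.re_ofReal_mul]
    · have h1 := (Complex.re_le_norm _).trans (norm_inner_le_norm (𝕜 := ℂ) (hA.flow b t x u + x)
        (resolventOp A 0 (hA.forced b t u)))
      have h2 := mul_le_mul_of_nonneg_left (hA.norm_resolventOp_forced_le b ht.le u)
        (norm_nonneg (hA.flow b t x u + x))
      rw [one_div, inv_mul_le_iff₀ ht]
      linarith
  refine (limsup_le_limsup hle).trans ?_
  have hlim' := ((continuous_coe_real_ereal.tendsto _).comp hlim).limsup_eq
  simp only [Function.comp_def] at hlim'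
  rw [hlim', EReal.coe_le_coe_iff,
    inner_neg_right, inner_add_left, ← two_smul ℝ x, norm_smul, Complex.neg_re, Complex.add_re]
  have h1 : (inner ℂ x x).re = ‖x‖ ^ 2 := inner_self_eq_norm_sq (𝕜 := ℂ) x
  rw [h1]
  simp only [Real.norm_ofNat]
  -- The limit is `-2‖x‖² + 2‖x‖‖u‖‖b‖`, and Young's inequality gives up one of the two `‖x‖²`.
  nlinarith [sq_nonneg (‖x‖ - ‖u‖ * ‖b‖), sq_nonneg ‖u‖]

theorem re_inner_resolventOp_pos {x : X} (hx : x ≠ 0) :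
    0 < (inner ℂ x (resolventOp A 0 x)).re := by
  rw [hA.resolventOp_eq]
  exact inner_diag_self_pos e _ _ (fun n => inv_pos.2 (hA.pos n)) hx

theorem isNoncoerciveISSLyapunov [CompleteSpace X] (b : X) :
    IsNoncoerciveISSLyapunov (hA.flow b) (fun x => (inner ℂ x (resolventOp A 0 x)).re) := by
  refine ⟨by fun_prop, fun x => ?_, _, _, _,
    classKInf_const_mul_sq (c := ‖resolventOp A 0‖ + 1) (by positivity),
    classKInf_const_mul_sq one_pos,
    (classKInf_const_mul_sq (c := ‖b‖ ^ 2 + 1) (by positivity)).1,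
    fun x hx => ⟨hA.re_inner_resolventOp_pos hx, ?_⟩, hA.diniDeriv_le b⟩
  · rcases eq_or_ne x 0 with rfl | hx
    · simp
    · exact (hA.re_inner_resolventOp_pos hx).le
  · have h1 := (Complex.re_le_norm _).trans (norm_inner_le_norm (𝕜 := ℂ) x (resolventOp A 0 x))
    have h2 := mul_le_mul_of_nonneg_left ((resolventOp A 0).le_opNorm x) (norm_nonneg x)
    nlinarith [sq_nonneg ‖x‖]

/-! ### The input operator -/

variable [CompleteSpace X]

/-- The input operator `-A₋₁ b`. -/
def inputOp (b : X) : ℂ →L[ℂ] Extrapolation A 0 :=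
  ((extResolventEquiv A 0 hA.denseRange_resolventOp).symm.toContinuousLinearEquiv :
    X →L[ℂ] Extrapolation A 0).comp (ContinuousLinearMap.toSpanSingleton ℂ b)

theorem extResolventEquiv_inputOp (b : X) (c : ℂ) :
    extResolventEquiv A 0 hA.denseRange_resolventOp (hA.inputOp b c) = c • b :=
  (extResolventEquiv A 0 hA.denseRange_resolventOp).apply_symm_apply (c • b)

/-- Seen in `X`, the quotients at `z` are those of `R z` and tend to `-z`. By hypothesis `-z = R w -
c • b`, the image of `emb A 0 w - hA.inputOp b c`. -/
theorem generatorMapsTo_extend (b z w : X) (c : ℂ) (h : (z - c • b, w) ∈ A.graph) :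
    GeneratorMapsTo (fun t => extend A 0 (hA.semigroup t)) (emb A 0 z)
      (emb A 0 w - hA.inputOp b c) := by
  rw [hA.mem_graph_iff'] at h
  have h1 := hA.tendsto_resolventOp z
  have hz : -z = resolventOp A 0 w - c • b := by
    rw [← neg_neg (resolventOp A 0 w), ← h]
    abel
  rw [hz] at h1
  have h2 := ((extResolventEquiv A 0 hA.denseRange_resolventOp).symm.continuous.tendsto _).comp h1
  have h3 : (extResolventEquiv A 0 hA.denseRange_resolventOp).symm (resolventOp A 0 w - c • b)
      = emb A 0 w - hA.inputOp b c := by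
    rw [LinearIsometryEquiv.symm_apply_eq, map_sub, extResolventEquiv_emb,
      hA.extResolventEquiv_inputOp]
  rw [h3] at h2
  refine h2.congr fun t => ?_
  rw [Function.comp_apply, LinearIsometryEquiv.symm_apply_eq, map_smul, map_sub,
    extResolventEquiv_extend _ (hA.resolventOp_semigroup t), extResolventEquiv_emb]

/-- The identification of `X₋₁` with `X` carries the integrand to `u s • T(t - s) b`, so the formula
is `resolventOp_forced`. -/
theorem isMildSolutionMap (b : X) :
    IsMildSolutionMap A 0 hA.semigroup (hA.inputOp b) (hA.flow b) := by
  intro t ht x u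
  have h0 : ∀ s, extend A 0 (hA.semigroup (t - s)) (hA.inputOp b (u s))
      = (extResolventEquiv A 0 hA.denseRange_resolventOp).symm
        (u s • hA.semigroup (t - s) b) := fun s => by
    rw [LinearIsometryEquiv.eq_symm_apply, extResolventEquiv_extend _ (hA.resolventOp_semigroup _),
      hA.extResolventEquiv_inputOp, map_smul]
  have hi := hA.intervalIntegrable_smul_semigroup b ht u
  simp only [h0]
  constructor
  · rw [intervalIntegrable_iff] at hi ⊢
    exact ((extResolventEquiv A 0 hA.denseRange_resolventOp).symm.toContinuousLinearEquiv :
      X →L[ℂ] Extrapolation A 0).integrable_comp hi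
  · have h1 := (extResolventEquiv A 0
      hA.denseRange_resolventOp).symm.toLinearIsometry.intervalIntegral_comp_comm
        (a := 0) (b := t) (μ := volume) (fun s => u s • hA.semigroup (t - s) b)
    rw [← hA.resolventOp_forced b ht] at h1
    simp only [LinearIsometryEquiv.coe_toLinearIsometry] at h1
    rw [h1]
    apply (extResolventEquiv A 0 hA.denseRange_resolventOp).injective
    rw [map_add, LinearIsometryEquiv.apply_symm_apply, extResolventEquiv_emb,
      extResolventEquiv_emb, flow, map_add]

end IsDiagonal

/-! ### Continuous functions as elements of `L²(0,1)` -/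

theorem memLp_of_continuous {F : ℝ → ℂ} (hF : Continuous F) :
    MemLp F 2 (volume.restrict (Ioo (0 : ℝ) 1)) := by
  obtain ⟨C, hC⟩ := isCompact_Icc.exists_bound_of_continuousOn (s := Icc (0 : ℝ) 1)
    hF.continuousOn
  refine MemLp.of_bound hF.aestronglyMeasurable C ?_
  filter_upwards [ae_restrict_mem measurableSet_Ioo] with ξ hξ
  exact hC ξ (Ioo_subset_Icc_self hξ)

/-- The class in `L²(0,1)` of a continuous function. -/
def ofCont (F : ℝ → ℂ) (hF : Continuous F) : L2 := (memLp_of_continuous hF).toLp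

theorem coeFn_ofCont (F : ℝ → ℂ) (hF : Continuous F) :
    ofCont F hF =ᵐ[volume.restrict (Ioo (0 : ℝ) 1)] F := (memLp_of_continuous hF).coeFn_toLp

theorem eq_ofCont {f : L2} {F : ℝ → ℂ} {hF : Continuous F}
    (h : f =ᵐ[volume.restrict (Ioo (0 : ℝ) 1)] F) : f = ofCont F hF :=
  Lp.ext (h.trans (coeFn_ofCont F hF).symm)

theorem ofCont_smul (c : ℂ) {F : ℝ → ℂ} (hF : Continuous F) :
    ofCont (fun ξ => c * F ξ) (hF.const_mul c) = c • ofCont F hF := rfl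

theorem setIntegral_Ioo_eq (F : ℝ → ℂ) :
    ∫ ξ in Ioo (0 : ℝ) 1, F ξ = ∫ ξ in (0 : ℝ)..1, F ξ := by
  rw [intervalIntegral.integral_of_le zero_le_one, integral_Ioc_eq_integral_Ioo]

theorem integral_smul_ofCont (ζ : ℝ → ℝ) (F : ℝ → ℂ) (hF : Continuous F) :
    ∫ ξ in Ioo (0 : ℝ) 1, ζ ξ • ofCont F hF ξ = ∫ ξ in (0 : ℝ)..1, ζ ξ • F ξ := by
  rw [← setIntegral_Ioo_eq]
  refine integral_congr_ae ?_
  filter_upwards [coeFn_ofCont F hF] with ξ hξ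
  rw [hξ]

theorem hasValueAt_ofCont (F : ℝ → ℂ) (hF : Continuous F) (ξ : ℝ) :
    HasValueAt (ofCont F hF) ξ (F ξ) := ⟨F, hF.continuousOn, coeFn_ofCont F hF, rfl⟩

/-- Continuous functions that agree almost everywhere on `(0,1)` agree on `[0,1]`, endpoints
included; boundary values are thus well defined. -/
theorem HasValueAt.eq_of_ofCont {F : ℝ → ℂ} {hF : Continuous F} {ξ : ℝ} {c : ℂ}
    (h : HasValueAt (ofCont F hF) ξ c) (hξ : ξ ∈ Icc (0 : ℝ) 1) : F ξ = c := by
  obtain ⟨G, h1, h2, rfl⟩ := h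
  refine Measure.eqOn_Icc_of_ae_eq (μ := volume) (zero_ne_one (α := ℝ)) ?_ hF.continuousOn h1 hξ
  rw [← restrict_Ioo_eq_restrict_Icc]
  exact (coeFn_ofCont F hF).symm.trans h2

/-! ### Primitives -/

/-- Fubini on the triangle `τ ≤ ξ`: an integration by parts that asks only integrability of `h`. It
serves for test functions and, with `η = id`, for iterated primitives. -/
theorem integral_smul_primitive {h : ℝ → ℂ} (hh : Integrable h) {η η' : ℝ → ℝ}
    (hη : ∀ x, HasDerivAt η (η' x) x) (hc : Continuous η') {b : ℝ} (hb : 0 ≤ b) :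
    ∫ ξ in (0 : ℝ)..b, η' ξ • ∫ τ in (0 : ℝ)..ξ, h τ
      = ∫ τ in (0 : ℝ)..b, (η b - η τ) • h τ := by
  set μ := volume.restrict (Ioc (0 : ℝ) b) with hμ
  have hint : Integrable (fun p : ℝ × ℝ => {p : ℝ × ℝ | p.2 ≤ p.1}.indicator
      (fun p => η' p.1 • h p.2) p) (μ.prod μ) := by
    refine Integrable.indicator ?_ (measurableSet_le measurable_snd measurable_fst)
    exact Integrable.smul_prod (hc.integrableOn_Ioc) hh.restrict
  have hsw := integral_integral_swap (f := fun ξ τ => {p : ℝ × ℝ | p.2 ≤ p.1}.indicator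
      (fun p => η' p.1 • h p.2) (ξ, τ)) hint
  rw [intervalIntegral.integral_of_le hb, intervalIntegral.integral_of_le hb]
  refine Eq.trans (integral_congr_ae ?_) (hsw.trans (integral_congr_ae ?_))
  · filter_upwards [ae_restrict_mem measurableSet_Ioc] with ξ hξ
    rw [intervalIntegral.integral_of_le hξ.1.le, ← integral_smul, hμ,
      ← integral_indicator measurableSet_Ioc, ← integral_indicator measurableSet_Ioc]
    congr 1 with τ
    by_cases h1 : τ ∈ Ioc 0 ξ
    · have h2 : τ ∈ Ioc 0 b := ⟨h1.1, h1.2.trans hξ.2⟩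
      have h3 : (ξ, τ) ∈ {p : ℝ × ℝ | p.2 ≤ p.1} := h1.2
      rw [indicator_of_mem h1, indicator_of_mem h2, indicator_of_mem h3]
    · rw [indicator_of_notMem h1]
      by_cases h2 : τ ∈ Ioc 0 b
      · have h3 : (ξ, τ) ∉ {p : ℝ × ℝ | p.2 ≤ p.1} := fun h3 => h1 ⟨h2.1, h3⟩
        rw [indicator_of_mem h2, indicator_of_notMem h3]
      · rw [indicator_of_notMem h2]
  · filter_upwards [ae_restrict_mem measurableSet_Ioc] with τ hτ
    have e1 : η b - η τ = ∫ ξ in τ..b, η' ξ :=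
      (intervalIntegral.integral_eq_sub_of_hasDerivAt (fun x _ => hη x)
        (hc.intervalIntegrable _ _)).symm
    -- The slice of the triangle at height `τ` is the closed interval `[τ, b]`, hence the passage
    -- from `Ioc` to `Icc`.
    rw [e1, intervalIntegral.integral_of_le hτ.2, ← integral_smul_const, hμ,
      ← integral_Icc_eq_integral_Ioc (f := fun ξ => η' ξ • h τ), ← integral_indicator measurableSet_Ioc,
      ← integral_indicator measurableSet_Icc]
    congr 1 with ξ
    by_cases h1 : ξ ∈ Icc τ b
    · have h2 : ξ ∈ Ioc 0 b := ⟨hτ.1.trans_le h1.1, h1.2⟩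
      have h3 : (ξ, τ) ∈ {p : ℝ × ℝ | p.2 ≤ p.1} := h1.1
      rw [indicator_of_mem h1, indicator_of_mem h2, indicator_of_mem h3]
    · rw [indicator_of_notMem h1]
      by_cases h2 : ξ ∈ Ioc 0 b
      · have h3 : (ξ, τ) ∉ {p : ℝ × ℝ | p.2 ≤ p.1} := fun h3 => h1 ⟨h3, h2.2⟩
        rw [indicator_of_mem h2, indicator_of_notMem h3]
      · rw [indicator_of_notMem h2]

theorem integrable_indicator_L2 (g : L2) : Integrable ((Ioo (0 : ℝ) 1).indicator g) :=
  (integrable_indicator_iff measurableSet_Ioo).2 ((Lp.memLp g).integrable (by norm_num))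

theorem intervalIntegral_indicator (g : ℝ → ℂ) {s t : ℝ} (hs : s ∈ Icc (0 : ℝ) 1)
    (ht : t ∈ Icc (0 : ℝ) 1) (w : ℝ → ℂ) :
    ∫ τ in s..t, w τ * (Ioo (0 : ℝ) 1).indicator g τ = ∫ τ in s..t, w τ * g τ := by
  refine intervalIntegral.integral_congr_ae_restrict ?_
  have h1 : ∀ᵐ τ ∂(volume.restrict (uIoc s t)), τ ≠ 1 := by
    refine ae_restrict_of_ae ?_
    exact (measure_eq_zero_iff_ae_notMem.1 (Real.volume_singleton (a := 1)))
  filter_upwards [h1, ae_restrict_mem measurableSet_uIoc] with τ h2 h3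
  have h4 : τ ∈ Ioo (0 : ℝ) 1 :=
    ⟨(le_min hs.1 ht.1).trans_lt h3.1, lt_of_le_of_ne (h3.2.trans (max_le hs.2 ht.2)) h2⟩
  rw [indicator_of_mem h4]

/-- The primitive of `g ∈ L²(0,1)` that vanishes at `0`. -/
def prim (g : L2) (ξ : ℝ) : ℂ := ∫ τ in (0 : ℝ)..ξ, (Ioo (0 : ℝ) 1).indicator g τ

theorem continuous_prim (g : L2) : Continuous (prim g) :=
  intervalIntegral.continuous_primitive
    (fun _ _ => (integrable_indicator_L2 g).intervalIntegrable) 0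

/-! ### Weak derivatives -/

theorem isWeakDeriv_prim (g : L2) : IsWeakDeriv (ofCont (prim g) (continuous_prim g)) g := by
  intro η h1 h2 h3
  have hη1 : η 1 = 0 := image_eq_zero_of_notMem_tsupport fun h => by simpa using h3 h
  rw [integral_smul_ofCont]
  unfold prim
  rw [integral_smul_primitive (integrable_indicator_L2 g)
    (fun x => (h1.differentiable (by simp)).differentiableAt.hasDerivAt)
    (h1.continuous_deriv (by simp)) zero_le_one, ← setIntegral_Ioo_eq, ← integral_neg]
  refine setIntegral_congr_fun measurableSet_Ioo fun τ hτ => ?_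
  rw [indicator_of_mem hτ, hη1, zero_sub, neg_smul]

theorem isWeakDeriv_of_hasDerivAt {F F' : ℝ → ℂ} (hF : Continuous F) (hF' : Continuous F')
    (h : ∀ x, HasDerivAt F (F' x) x) : IsWeakDeriv (ofCont F hF) (ofCont F' hF') := by
  intro η h1 h2 h3
  have hη0 : η 0 = 0 := image_eq_zero_of_notMem_tsupport fun h => by simpa using h3 h
  have hη1 : η 1 = 0 := image_eq_zero_of_notMem_tsupport fun h => by simpa using h3 h
  have hc : Continuous (deriv η) := h1.continuous_deriv (by simp)
  have hc' := h1.continuous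
  rw [integral_smul_ofCont, integral_smul_ofCont, eq_neg_iff_add_eq_zero,
    ← intervalIntegral.integral_add (Continuous.intervalIntegrable (by fun_prop) _ _)
      (Continuous.intervalIntegrable (by fun_prop) _ _),
    intervalIntegral.integral_eq_sub_of_hasDerivAt (f := fun x => η x • F x)
      (fun x _ => ?_) (Continuous.intervalIntegrable (by fun_prop) _ _)]
  · simp [hη0, hη1]
  · rw [add_comm]
    exact ((h1.differentiable (by simp)).differentiableAt.hasDerivAt).smul (h x)

theorem isWeakDeriv_const (c : ℂ) : IsWeakDeriv (ofCont (fun _ => c) continuous_const) 0 := by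
  have h := isWeakDeriv_of_hasDerivAt (F := fun _ => c) continuous_const
    (F' := fun _ => (0 : ℂ)) continuous_const fun x => hasDerivAt_const x c
  rwa [show ofCont (fun _ => (0 : ℂ)) continuous_const = 0 from rfl] at h

theorem IsWeakDeriv.sub {f g f₂ g₂ : L2} (h : IsWeakDeriv f g) (h₂ : IsWeakDeriv f₂ g₂) :
    IsWeakDeriv (f - f₂) (g - g₂) := by
  have := h.add (h₂.smul (-1))
  simpa [sub_eq_add_neg] using this

/-- A compact subset of `(0,1)` is contained in a compact interval inside `(0,1)`. -/
theorem exists_Icc_of_isCompact {K : Set ℝ} (hK : IsCompact K) (hs : K ⊆ Ioo 0 1) :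
    ∃ a b : ℝ, 0 < a ∧ b < 1 ∧ K ⊆ Icc a b := by
  rcases K.eq_empty_or_nonempty with rfl | hne
  · exact ⟨1, 0, one_pos, zero_lt_one, empty_subset _⟩
  · obtain ⟨a, ha⟩ := hK.exists_isLeast hne
    obtain ⟨b, hb⟩ := hK.exists_isGreatest hne
    exact ⟨a, b, (hs ha.1).1, (hs hb.1).2, fun x hx => ⟨ha.2 hx, hb.2 hx⟩⟩

/-- A test function with vanishing integral is the derivative of a test function. -/
theorem exists_test_primitive {ψ : ℝ → ℝ} (h1 : ContDiff ℝ ∞ ψ) (h2 : HasCompactSupport ψ)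
    (h3 : tsupport ψ ⊆ Ioo 0 1) (h4 : ∫ x, ψ x = 0) :
    ∃ η : ℝ → ℝ, ContDiff ℝ ∞ η ∧ HasCompactSupport η ∧ tsupport η ⊆ Ioo 0 1 ∧ deriv η = ψ := by
  obtain ⟨a, b, ha, hb, hab⟩ := exists_Icc_of_isCompact h2 h3
  have hd : ∀ x, HasDerivAt (fun x => ∫ s in (0 : ℝ)..x, ψ s) (ψ x) x := fun x =>
    (h1.continuous.integral_hasStrictDerivAt 0 x).hasDerivAt
  have hderiv : deriv (fun x => ∫ s in (0 : ℝ)..x, ψ s) = ψ := funext fun x => (hd x).deriv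
  have hz : ∀ x, x ∉ Icc a b → ψ x = 0 := fun x hx =>
    image_eq_zero_of_notMem_tsupport fun h => hx (hab h)
  have hsupp : Function.support (fun x => ∫ s in (0 : ℝ)..x, ψ s) ⊆ Icc a b := by
    intro x hx
    by_contra hcon
    refine hx ?_
    simp only
    rcases lt_or_ge x a with h | h
    · refine (intervalIntegral.integral_congr (g := fun _ => (0 : ℝ)) fun s hs => ?_).trans
        intervalIntegral.integral_zero
      refine hz s fun hs' => ?_
      have := hs.2
      have h5 := hs'.1
      rcases max_cases (0 : ℝ) x with h6 | h6 <;> linarith [h6.1]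
    -- Beyond `b` the primitive already equals the whole integral of `ψ`, which is zero.
    · have hx' : b < x := by
        by_contra! h'
        exact hcon ⟨h, h'⟩
      have h0 : (0 : ℝ) ≤ x := ha.le.trans h
      rw [intervalIntegral.integral_of_le h0]
      refine (setIntegral_eq_integral_of_forall_compl_eq_zero
        fun s hs => hz s fun hs' => hs ?_).trans h4
      exact ⟨ha.trans_le hs'.1, hs'.2.trans hx'.le⟩
  have hts := closure_minimal hsupp isClosed_Icc
  refine ⟨_, ?_, ?_, hts.trans (Icc_subset_Ioo ha hb), hderiv⟩
  · rw [contDiff_infty_iff_deriv, hderiv]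
    exact ⟨fun x => (hd x).differentiableAt, h1⟩
  · exact HasCompactSupport.of_support_subset_isCompact isCompact_Icc hsupp

theorem integral_test_eq {ψ : ℝ → ℝ} (h3 : tsupport ψ ⊆ Ioo 0 1) :
    ∫ ξ in Ioo (0 : ℝ) 1, ψ ξ = ∫ ξ, ψ ξ :=
  setIntegral_eq_integral_of_forall_compl_eq_zero fun _ hξ =>
    image_eq_zero_of_notMem_tsupport fun hh => hξ (h3 hh)

/-- The lemma of du Bois-Reymond. -/
theorem IsWeakDeriv.eq_const {f : L2} (h : IsWeakDeriv f 0) :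
    ∃ c : ℂ, f = ofCont (fun _ => c) continuous_const := by
  let φ : ContDiffBump (1 / 2 : ℝ) := ⟨1 / 8, 1 / 4, by norm_num, by norm_num⟩
  set φ₀ := φ.normed volume with hφ₀
  have hφ1 : ContDiff ℝ ∞ φ₀ := φ.contDiff_normed (n := ⊤)
  have hφ2 : HasCompactSupport φ₀ := φ.hasCompactSupport_normed
  have hφ3 : tsupport φ₀ ⊆ Ioo 0 1 := by
    rw [hφ₀, φ.tsupport_normed_eq, Real.closedBall_eq_Icc]
    exact Icc_subset_Ioo (by norm_num [φ]) (by norm_num [φ])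
  have hφ4 : ∫ x, φ₀ x = 1 := φ.integral_normed
  set c : ℂ := ∫ ξ in Ioo (0 : ℝ) 1, φ₀ ξ • f ξ with hc
  refine ⟨c, eq_ofCont ?_⟩
  have hloc : LocallyIntegrableOn (fun ξ => f ξ - c) (Ioo (0 : ℝ) 1) :=
    IntegrableOn.locallyIntegrableOn
      (((Lp.memLp f).integrable (by norm_num)).sub (integrable_const c))
  have key := isOpen_Ioo.ae_eq_zero_of_integral_contDiff_smul_eq_zero hloc fun ζ h1 h2 h3 => ?_
  · refine (ae_restrict_iff' measurableSet_Ioo).2 (key.mono fun ξ h1 h2 => ?_)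
    exact sub_eq_zero.1 (h1 h2)
  -- The function `ζ - m * φ₀` has integral zero, so it is the derivative of a test function and
  -- pairs to zero with `f`. Hence `∫ ζ f = m c = ∫ ζ c`.
  · set m : ℝ := ∫ x, ζ x with hm
    have t1 : tsupport (fun x => ζ x - m * φ₀ x) ⊆ Ioo 0 1 :=
      (tsupport_sub _ _).trans (union_subset h3 ((tsupport_mul_subset_right).trans hφ3))
    have t2 : ∫ x, (ζ x - m * φ₀ x) = 0 := by
      rw [integral_sub (h1.continuous.integrable_of_hasCompactSupport h2)
        ((hφ1.continuous.integrable_of_hasCompactSupport hφ2).const_mul m),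
        integral_const_mul, hφ4, mul_one, sub_self]
    obtain ⟨η, e1, e2, e3, e4⟩ := exists_test_primitive
      (h1.sub (contDiff_const.mul hφ1)) (h2.sub (hφ2.mul_left)) t1 t2
    have h5 := h η e1 e2 e3
    have h6 : ∫ ξ in Ioo (0 : ℝ) 1, η ξ • (0 : L2) ξ = 0 := integral_eq_zero_of_ae (by
      filter_upwards [Lp.coeFn_zero ℂ 2 (volume.restrict (Ioo (0 : ℝ) 1))] with ξ hξ
      rw [hξ, Pi.zero_apply, smul_zero])
    rw [h6, neg_zero, e4] at h5
    have i1 := integrable_test_smul f ζ h1.continuous h2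
    have i2 := integrable_test_smul f φ₀ hφ1.continuous hφ2
    have h7 : ∫ ξ in Ioo (0 : ℝ) 1, ζ ξ • f ξ = m • c := by
      rw [hc, ← integral_smul, ← sub_eq_zero, ← integral_sub i1 (i2.fun_smul m), ← h5]
      congr 1 with ξ
      rw [sub_smul, mul_smul]
    have h8 : ∫ ξ in Ioo (0 : ℝ) 1, ζ ξ • c = m • c := by
      rw [integral_smul_const, integral_test_eq h3]
    have i3 : Integrable (fun ξ => ζ ξ • c) (volume.restrict (Ioo (0 : ℝ) 1)) :=
      (h1.continuous.integrable_of_hasCompactSupport h2).restrict.smul_const c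
    rw [← setIntegral_eq_integral_of_forall_compl_eq_zero (s := Ioo (0 : ℝ) 1)]
    · simp only [smul_sub]
      rw [integral_sub i1 i3, h7, h8, sub_self]
    · intro ξ hξ
      rw [image_eq_zero_of_notMem_tsupport fun hh => hξ (h3 hh), zero_smul]

/-! ### The solution operator of `f'' = g`, `f(0) = f(1) = 0` -/

theorem continuous_integral_prim (g : L2) : Continuous fun ξ => ∫ τ in (0 : ℝ)..ξ, prim g τ :=
  intervalIntegral.continuous_primitive
    (fun _ _ => (continuous_prim g).intervalIntegrable _ _) 0

/-- The solution of `f'' = g`, `f(0) = f(1) = 0`. -/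
def green (g : L2) (ξ : ℝ) : ℂ :=
  (∫ τ in (0 : ℝ)..ξ, prim g τ) - (ξ : ℂ) * ∫ τ in (0 : ℝ)..1, prim g τ

theorem continuous_green (g : L2) : Continuous (green g) :=
  (continuous_integral_prim g).sub (Complex.continuous_ofReal.mul continuous_const)

/-- `green g` as an element of `L²(0,1)`. -/
def greenL2 (g : L2) : L2 := ofCont (green g) (continuous_green g)

theorem hasValueAt_greenL2_zero (g : L2) : HasValueAt (greenL2 g) 0 0 := by
  have := hasValueAt_ofCont (green g) (continuous_green g) 0
  rwa [show green g 0 = 0 by simp [green]] at this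

theorem hasValueAt_greenL2_one (g : L2) : HasValueAt (greenL2 g) 1 0 := by
  have := hasValueAt_ofCont (green g) (continuous_green g) 1
  rwa [show green g 1 = 0 by simp [green]] at this

theorem hasSecondWeakDeriv_greenL2 (g : L2) : HasSecondWeakDeriv (greenL2 g) g := by
  set c : ℂ := -∫ τ in (0 : ℝ)..1, prim g τ with hc
  refine ⟨ofCont (fun ξ => prim g ξ + c) ((continuous_prim g).add continuous_const),
    isWeakDeriv_of_hasDerivAt _ _ fun x => ?_, ?_⟩
  · have h1 := ((continuous_prim g).integral_hasStrictDerivAt 0 x).hasDerivAt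
    have h2 := ((Complex.ofRealCLM.hasDerivAt (x := x))).mul_const (∫ τ in (0 : ℝ)..1, prim g τ)
    convert! h1.sub h2 using 1
    simp [hc, sub_eq_add_neg]
  · have := (isWeakDeriv_prim g).add (isWeakDeriv_const c)
    rwa [add_zero] at this

theorem HasSecondWeakDeriv.add {f g f₂ g₂ : L2} (h : HasSecondWeakDeriv f g)
    (h₂ : HasSecondWeakDeriv f₂ g₂) : HasSecondWeakDeriv (f + f₂) (g + g₂) := by
  obtain ⟨f', h1, h2⟩ := h
  obtain ⟨k', k1, k2⟩ := h₂
  exact ⟨f' + k', h1.add k1, h2.add k2⟩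

theorem HasSecondWeakDeriv.smul {f g : L2} (c : ℂ) (h : HasSecondWeakDeriv f g) :
    HasSecondWeakDeriv (c • f) (c • g) := by
  obtain ⟨f', h1, h2⟩ := h
  exact ⟨c • f', h1.smul c, h2.smul c⟩

theorem hasDerivAt_mul_ofReal (c : ℂ) (x : ℝ) : HasDerivAt (fun ξ : ℝ => c * (ξ : ℂ)) c x := by
  simpa using (Complex.ofRealCLM.hasDerivAt (x := x)).const_mul c

theorem isWeakDeriv_mul_ofReal (c : ℂ) :
    IsWeakDeriv (ofCont (fun ξ : ℝ => c * (ξ : ℂ)) (by fun_prop))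
      (ofCont (fun _ => c) continuous_const) :=
  isWeakDeriv_of_hasDerivAt _ _ (hasDerivAt_mul_ofReal c)

/-- Two applications of du Bois-Reymond show that `f` is affine, and its two boundary values vanish.
-/
theorem eq_zero_of_hasSecondWeakDeriv_zero {f : L2} (h : HasSecondWeakDeriv f 0)
    (h0 : HasValueAt f 0 0) (h1 : HasValueAt f 1 0) : f = 0 := by
  obtain ⟨f', hf, hf'⟩ := h
  obtain ⟨c, rfl⟩ := hf'.eq_const
  have h2 := hf.sub (isWeakDeriv_mul_ofReal c)
  rw [sub_self] at h2
  obtain ⟨d, hd⟩ := h2.eq_const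
  have h3 : f = ofCont (fun ξ : ℝ => d + c * (ξ : ℂ)) (by fun_prop) := by
    rw [sub_eq_iff_eq_add.1 hd]
    rfl
  rw [h3] at h0 h1
  have e0 := h0.eq_of_ofCont (left_mem_Icc.2 zero_le_one)
  have e1 := h1.eq_of_ofCont (right_mem_Icc.2 zero_le_one)
  have ed : d = 0 := by simpa using e0
  have ec : c = 0 := by simpa [ed] using e1
  rw [h3]
  simp only [ed, ec, zero_mul, add_zero]
  rfl

/-- Uniqueness reduces the linearity of `greenL2`, its role as inverse and its action on sines to
checking second derivatives and boundary values. -/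
theorem eq_greenL2 {f g : L2} (h : HasSecondWeakDeriv f g) (h0 : HasValueAt f 0 0)
    (h1 : HasValueAt f 1 0) : f = greenL2 g := by
  refine sub_eq_zero.1 (eq_zero_of_hasSecondWeakDeriv_zero ?_ ?_ ?_)
  · simpa [sub_eq_add_neg] using h.add ((hasSecondWeakDeriv_greenL2 g).smul (-1))
  · simpa [sub_eq_add_neg] using h0.add ((hasValueAt_greenL2_zero g).smul (-1))
  · simpa [sub_eq_add_neg] using h1.add ((hasValueAt_greenL2_one g).smul (-1))

/-! ### Boundedness of the Green operator -/

instance : IsProbabilityMeasure (volume.restrict (Ioo (0 : ℝ) 1)) := ⟨by simp⟩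

theorem integral_norm_le_norm (g : L2) : ∫ ξ in Ioo (0 : ℝ) 1, ‖g ξ‖ ≤ ‖g‖ := by
  rw [integral_norm_eq_lintegral_enorm (Lp.aestronglyMeasurable g), Lp.norm_def,
    ← eLpNorm_one_eq_lintegral_enorm]
  exact ENNReal.toReal_mono (Lp.memLp g).2.ne
    (eLpNorm_le_eLpNorm_of_exponent_le (by norm_num) (Lp.aestronglyMeasurable g))

theorem norm_prim_le (g : L2) (ξ : ℝ) : ‖prim g ξ‖ ≤ ‖g‖ := by
  refine (intervalIntegral.norm_integral_le_integral_norm_uIoc).trans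
    (le_trans ?_ (integral_norm_le_norm g))
  rw [← integral_indicator measurableSet_Ioo]
  simp only [norm_indicator_eq_indicator_norm]
  exact setIntegral_le_integral
    ((integrable_indicator_L2 g).norm.congr (by simp [norm_indicator_eq_indicator_norm]))
    (Eventually.of_forall fun x => indicator_nonneg (fun _ _ => norm_nonneg _) x)

theorem norm_greenL2_le (g : L2) : ‖greenL2 g‖ ≤ 2 * ‖g‖ := by
  have h1 : ∀ ξ ∈ Icc (0 : ℝ) 1, ‖∫ τ in (0 : ℝ)..ξ, prim g τ‖ ≤ ‖g‖ := fun ξ hξ => by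
    have := intervalIntegral.norm_integral_le_of_norm_le_const (a := 0) (b := ξ)
      (f := prim g) (C := ‖g‖) fun x _ => norm_prim_le g x
    rw [sub_zero, abs_of_nonneg hξ.1] at this
    exact this.trans (mul_le_of_le_one_right (norm_nonneg g) hξ.2)
  have h2 : ∀ᵐ ξ ∂(volume.restrict (Ioo (0 : ℝ) 1)), ‖greenL2 g ξ‖ ≤ 2 * ‖g‖ := by
    filter_upwards [coeFn_ofCont (green g) (continuous_green g),
      ae_restrict_mem measurableSet_Ioo] with ξ hξ hξ'
    rw [greenL2, hξ, green]
    refine (norm_sub_le _ _).trans ?_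
    rw [norm_mul, Complex.norm_real, Real.norm_of_nonneg hξ'.1.le]
    have h3 := h1 ξ (Ioo_subset_Icc_self hξ')
    have h4 := h1 1 (right_mem_Icc.2 zero_le_one)
    have h5 := mul_le_mul hξ'.2.le h4 (norm_nonneg _) zero_le_one
    linarith
  have h3 := Lp.norm_le_of_ae_bound (by positivity) h2
  simpa [measureUnivNNReal] using h3

/-- `greenL2` as a bounded operator on `L²(0,1)`. -/
def greenCLM : L2 →L[ℂ] L2 :=
  LinearMap.mkContinuous
    { toFun := greenL2
      map_add' := fun x y => (eq_greenL2
        ((hasSecondWeakDeriv_greenL2 x).add (hasSecondWeakDeriv_greenL2 y))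
        (by simpa using (hasValueAt_greenL2_zero x).add (hasValueAt_greenL2_zero y))
        (by simpa using (hasValueAt_greenL2_one x).add (hasValueAt_greenL2_one y))).symm
      map_smul' := fun c x => (eq_greenL2 ((hasSecondWeakDeriv_greenL2 x).smul c)
        (by simpa using (hasValueAt_greenL2_zero x).smul c)
        (by simpa using (hasValueAt_greenL2_one x).smul c)).symm } 2 norm_greenL2_le

theorem greenCLM_apply (g : L2) : greenCLM g = greenL2 g := rfl

theorem mem_graph_dirichletOp_iff {a : ℝ} (ha : a ≠ 0) (f g : L2) :
    (f, g) ∈ (dirichletOp a).graph ↔ f = greenCLM ((a : ℂ)⁻¹ • g) := by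
  have ha' : (a : ℂ) ≠ 0 := by exact_mod_cast ha
  rw [mem_graph_dirichletOp]
  constructor
  · rintro ⟨f'', h, h0, h1, rfl⟩
    rw [inv_smul_smul₀ ha']
    exact eq_greenL2 h h0 h1
  · rintro rfl
    exact ⟨_, hasSecondWeakDeriv_greenL2 _, hasValueAt_greenL2_zero _, hasValueAt_greenL2_one _,
      (smul_inv_smul₀ ha' g).symm⟩

/-! ### The sine basis -/

/-- The function `√2 sin((n + 1) π ξ)`. -/
def sineFn (n : ℕ) (ξ : ℝ) : ℂ := ((√2 * Real.sin ((n + 1) * Real.pi * ξ) : ℝ) : ℂ)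

theorem continuous_sineFn (n : ℕ) : Continuous (sineFn n) := by
  unfold sineFn
  fun_prop

/-- The normalized eigenfunctions of the Dirichlet Laplacian. -/
def sineL2 (n : ℕ) : L2 := ofCont (sineFn n) (continuous_sineFn n)

theorem hasSecondWeakDeriv_sineL2 (n : ℕ) :
    HasSecondWeakDeriv (sineL2 n) ((-(((n + 1) * Real.pi : ℝ) : ℂ) ^ 2) • sineL2 n) := by
  set k : ℝ := (n + 1) * Real.pi with hk
  have hlin : ∀ x : ℝ, HasDerivAt (fun x : ℝ => k * x) k x := fun x => by
    simpa using (hasDerivAt_id x).const_mul k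
  refine ⟨ofCont (fun ξ => ((√2 * (Real.cos (k * ξ) * k) : ℝ) : ℂ)) (by fun_prop),
    isWeakDeriv_of_hasDerivAt _ _ fun x => ?_, ?_⟩
  · exact (((hlin x).sin.const_mul √2)).ofReal_comp
  · rw [sineL2, ← ofCont_smul]
    refine isWeakDeriv_of_hasDerivAt _ _ fun x => ?_
    convert! ((((hlin x).cos.mul_const k).const_mul √2)).ofReal_comp using 1
    simp only [sineFn, ← hk]
    push_cast
    ring

theorem hasValueAt_sineL2_zero (n : ℕ) : HasValueAt (sineL2 n) 0 0 := by
  have := hasValueAt_ofCont (sineFn n) (continuous_sineFn n) 0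
  rwa [show sineFn n 0 = 0 by simp [sineFn]] at this

theorem hasValueAt_sineL2_one (n : ℕ) : HasValueAt (sineL2 n) 1 0 := by
  have h : Real.sin ((n + 1) * Real.pi) = 0 := by exact_mod_cast Real.sin_nat_mul_pi (n + 1)
  have := hasValueAt_ofCont (sineFn n) (continuous_sineFn n) 1
  rwa [sineFn, mul_one, h, mul_zero, Complex.ofReal_zero] at this

/-- With `k = (n + 1)π` the sine has second derivative `-k²` times itself, so applying the Green
operator to that derivative recovers the sine. -/
theorem greenCLM_sineL2 (n : ℕ) :
    greenCLM (sineL2 n) = ((-(((n + 1) * Real.pi) ^ 2)⁻¹ : ℝ) : ℂ) • sineL2 n := by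
  have h := eq_greenL2 (hasSecondWeakDeriv_sineL2 n) (hasValueAt_sineL2_zero n)
    (hasValueAt_sineL2_one n)
  have hk : (((n + 1) * Real.pi : ℝ) : ℂ) ≠ 0 := by
    have : (0 : ℝ) < (n + 1) * Real.pi := by positivity
    exact_mod_cast this.ne'
  rw [← greenCLM_apply, map_smul] at h
  nth_rewrite 2 [h]
  rw [smul_smul]
  generalize ((n + 1) * Real.pi : ℝ) = k at hk
  have : ((-(k ^ 2)⁻¹ : ℝ) : ℂ) * -((k : ℂ) ^ 2) = 1 := by
    push_cast
    field_simp
  rw [this, one_smul]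

theorem inner_ofCont_left (F : ℝ → ℂ) (hF : Continuous F) (f : L2) :
    inner ℂ (ofCont F hF) f = ∫ ξ in Ioo (0 : ℝ) 1, f ξ * conj (F ξ) := by
  rw [L2.inner_def]
  refine integral_congr_ae ?_
  filter_upwards [coeFn_ofCont F hF] with ξ hξ
  rw [hξ, RCLike.inner_apply]

theorem inner_sineL2 (n : ℕ) (f : L2) :
    inner ℂ (sineL2 n) f = (√2 : ℂ) * ∫ ξ in Ioo (0 : ℝ) 1,
      (Real.sin ((n + 1) * Real.pi * ξ) : ℂ) * f ξ := by
  rw [sineL2, inner_ofCont_left, ← integral_const_mul]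
  congr 1 with ξ
  rw [sineFn, Complex.conj_ofReal]
  push_cast
  ring

theorem integral_cos_int_mul_pi {k : ℤ} (hk : k ≠ 0) :
    ∫ ξ in (0 : ℝ)..1, Real.cos (k * Real.pi * ξ) = 0 := by
  have hk' : (k * Real.pi : ℝ) ≠ 0 := mul_ne_zero (by exact_mod_cast hk) Real.pi_ne_zero
  rw [intervalIntegral.integral_comp_mul_left (fun x => Real.cos x) hk', integral_cos]
  simp [Real.sin_int_mul_pi]

theorem orthonormal_sineL2 : Orthonormal ℂ sineL2 := by
  rw [orthonormal_iff_ite]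
  intro m n
  -- Product-to-sum formula; the frequency `m + n + 2` reflects the index shift in `sineFn` and
  -- never vanishes.
  have h1 : inner ℂ (sineL2 m) (sineL2 n) = ((∫ ξ in (0 : ℝ)..1,
      (Real.cos (((m - n : ℤ) : ℝ) * Real.pi * ξ)
        - Real.cos (((m + n + 2 : ℤ) : ℝ) * Real.pi * ξ)) : ℝ) : ℂ) := by
    rw [sineL2, inner_ofCont_left, ← intervalIntegral.integral_ofReal, ← setIntegral_Ioo_eq]
    refine integral_congr_ae ?_
    filter_upwards [coeFn_ofCont (sineFn n) (continuous_sineFn n)] with ξ hξ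
    rw [sineL2, hξ, sineFn, sineFn, Complex.conj_ofReal, ← Complex.ofReal_mul]
    congr 1
    have e1 : ((m - n : ℤ) : ℝ) * Real.pi * ξ
        = (m + 1) * Real.pi * ξ - (n + 1) * Real.pi * ξ := by push_cast; ring
    have e2 : ((m + n + 2 : ℤ) : ℝ) * Real.pi * ξ
        = (m + 1) * Real.pi * ξ + (n + 1) * Real.pi * ξ := by push_cast; ring
    rw [e1, e2, Real.cos_sub, Real.cos_add]
    have := Real.mul_self_sqrt (show (0 : ℝ) ≤ 2 by norm_num)
    linear_combination Real.sin ((m + 1) * Real.pi * ξ) * Real.sin ((n + 1) * Real.pi * ξ) * this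
  rw [h1, intervalIntegral.integral_sub (Continuous.intervalIntegrable (by fun_prop) _ _)
    (Continuous.intervalIntegrable (by fun_prop) _ _),
    integral_cos_int_mul_pi (k := m + n + 2) (by positivity)]
  split_ifs with h
  · subst h
    simp
  · rw [integral_cos_int_mul_pi (by omega)]
    simp

/-! ### Completeness of the sine system -/

theorem integrable_continuous_mul (f : L2) {φ : ℝ → ℝ} (hφ : Continuous φ) :
    Integrable (fun ξ => (φ ξ : ℂ) * f ξ) (volume.restrict (Ioo (0 : ℝ) 1)) := by
  obtain ⟨C, hC⟩ := isCompact_Icc.exists_bound_of_continuousOn (s := Icc (0 : ℝ) 1)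
    hφ.continuousOn
  refine Integrable.bdd_mul (c := C) ((Lp.memLp f).integrable (by norm_num))
    (Complex.continuous_ofReal.comp hφ).aestronglyMeasurable ?_
  filter_upwards [ae_restrict_mem measurableSet_Ioo] with ξ hξ
  rw [Complex.norm_real]
  exact hC ξ (Ioo_subset_Icc_self hξ)

/-- Induction on `k` by `2 sin(nθ) cos θ = sin((n + 1)θ) + sin((n - 1)θ)`. The statement covers all
`n` at once because each step uses both neighbours; `n = 0` is trivial. -/
theorem integral_sin_mul_cos_pow_eq_zero {f : L2} (hf : ∀ n, inner ℂ (sineL2 n) f = 0) (k : ℕ) :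
    ∀ n : ℕ, ∫ ξ in Ioo (0 : ℝ) 1, ((Real.sin (n * Real.pi * ξ)
      * Real.cos (Real.pi * ξ) ^ k : ℝ) : ℂ) * f ξ = 0 := by
  induction k with
  | zero =>
    intro n
    cases n with
    | zero => simp
    | succ n =>
      have := hf n
      rw [inner_sineL2] at this
      have h2 : (√2 : ℂ) ≠ 0 := by
        have : √2 ≠ 0 := by positivity
        exact_mod_cast this
      have := (mul_eq_zero.1 this).resolve_left h2
      simpa using this
  | succ k ih =>
    intro n
    cases n with
    | zero => simp
    | succ n =>
      have e : ∀ ξ : ℝ, ((Real.sin ((n + 1 : ℕ) * Real.pi * ξ)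
          * Real.cos (Real.pi * ξ) ^ (k + 1) : ℝ) : ℂ) * f ξ
          = (1 / 2 : ℂ) * (((Real.sin ((n + 2 : ℕ) * Real.pi * ξ)
            * Real.cos (Real.pi * ξ) ^ k : ℝ) : ℂ) * f ξ)
          + (1 / 2 : ℂ) * (((Real.sin (n * Real.pi * ξ)
            * Real.cos (Real.pi * ξ) ^ k : ℝ) : ℂ) * f ξ) := fun ξ => by
        have e1 : ((n + 2 : ℕ) : ℝ) * Real.pi * ξ
          = (n + 1 : ℕ) * Real.pi * ξ + Real.pi * ξ := by push_cast; ring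
        have e2 : (n : ℝ) * Real.pi * ξ
          = (n + 1 : ℕ) * Real.pi * ξ - Real.pi * ξ := by push_cast; ring
        rw [e1, e2, Real.sin_add, Real.sin_sub]
        push_cast
        ring
      simp only [e]
      rw [integral_add ((integrable_continuous_mul f (by fun_prop)).const_mul _)
        ((integrable_continuous_mul f (by fun_prop)).const_mul _), integral_const_mul,
        integral_const_mul, ih, ih]
      simp

theorem integral_sin_mul_polynomial_eq_zero {f : L2} (hf : ∀ n, inner ℂ (sineL2 n) f = 0)
    (p : Polynomial ℝ) :
    ∫ ξ in Ioo (0 : ℝ) 1, ((Real.sin (Real.pi * ξ)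
      * p.eval (Real.cos (Real.pi * ξ)) : ℝ) : ℂ) * f ξ = 0 := by
  induction p using Polynomial.induction_on' with
  | add p q hp hq =>
    have e : ∀ ξ : ℝ, ((Real.sin (Real.pi * ξ)
        * (p + q).eval (Real.cos (Real.pi * ξ)) : ℝ) : ℂ) * f ξ
        = ((Real.sin (Real.pi * ξ) * p.eval (Real.cos (Real.pi * ξ)) : ℝ) : ℂ) * f ξ
        + ((Real.sin (Real.pi * ξ) * q.eval (Real.cos (Real.pi * ξ)) : ℝ) : ℂ) * f ξ :=
      fun ξ => by
        rw [Polynomial.eval_add]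
        push_cast
        ring
    simp only [e]
    rw [integral_add (integrable_continuous_mul f (by fun_prop))
      (integrable_continuous_mul f (by fun_prop)), hp, hq, add_zero]
  | monomial k c =>
    have h := integral_sin_mul_cos_pow_eq_zero hf k 1
    have e : ∀ ξ : ℝ, ((Real.sin (Real.pi * ξ)
        * (Polynomial.monomial k c).eval (Real.cos (Real.pi * ξ)) : ℝ) : ℂ) * f ξ
        = (c : ℂ) * (((Real.sin ((1 : ℕ) * Real.pi * ξ) * Real.cos (Real.pi * ξ) ^ k : ℝ) : ℂ)
          * f ξ) := fun ξ => by
      rw [Polynomial.eval_monomial, Nat.cast_one, one_mul]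
      push_cast
      ring
    simp only [e]
    rw [integral_const_mul, h, mul_zero]

/-- On `[0,1]` the map `ξ ↦ cos(πξ)` is a homeomorphism onto `[-1,1]`, so `φ` is a continuous
function of `cos(πξ)` and Weierstrass approximation reduces the claim to polynomials. -/
theorem integral_sin_mul_continuous_eq_zero {f : L2} (hf : ∀ n, inner ℂ (sineL2 n) f = 0)
    {φ : ℝ → ℝ} (hφ : Continuous φ) :
    ∫ ξ in Ioo (0 : ℝ) 1, ((Real.sin (Real.pi * ξ) * φ ξ : ℝ) : ℂ) * f ξ = 0 := by
  rw [← norm_le_zero_iff]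
  refine le_of_forall_pos_le_add fun ε hε => ?_
  set ψ : ℝ → ℝ := fun x => φ (Real.arccos x / Real.pi) with hψ
  have hψc : Continuous ψ := by fun_prop
  -- The denominator is positive and bounds the `L¹` norm of `f`.
  have hε' : 0 < ε / (‖f‖ + 1) := by positivity
  obtain ⟨p, hp⟩ := exists_polynomial_near_of_continuousOn (-1) 1 ψ hψc.continuousOn _ hε'
  have h1 : ∀ ξ ∈ Ioo (0 : ℝ) 1, ψ (Real.cos (Real.pi * ξ)) = φ ξ := fun ξ hξ => by
    rw [hψ]
    simp only
    have := Real.pi_pos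
    rw [Real.arccos_cos (by have := hξ.1; positivity) (by nlinarith [hξ.2]),
      mul_div_cancel_left₀ _ this.ne']
  have i1 := integrable_continuous_mul f (φ := fun ξ => Real.sin (Real.pi * ξ) * φ ξ)
    (by fun_prop)
  have i2 := integrable_continuous_mul f (φ := fun ξ => Real.sin (Real.pi * ξ)
    * p.eval (Real.cos (Real.pi * ξ))) (by fun_prop)
  have h2 : ∫ ξ in Ioo (0 : ℝ) 1, ((Real.sin (Real.pi * ξ) * φ ξ : ℝ) : ℂ) * f ξ
      = ∫ ξ in Ioo (0 : ℝ) 1, (((Real.sin (Real.pi * ξ) * φ ξ : ℝ) : ℂ) * f ξ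
        - ((Real.sin (Real.pi * ξ) * p.eval (Real.cos (Real.pi * ξ)) : ℝ) : ℂ) * f ξ) := by
    rw [integral_sub i1 i2, integral_sin_mul_polynomial_eq_zero hf p, sub_zero]
  rw [h2, zero_add]
  have i3 : Integrable (fun ξ => ε / (‖f‖ + 1) * ‖f ξ‖) (volume.restrict (Ioo (0 : ℝ) 1)) :=
    (((Lp.memLp f).integrable (by norm_num)).norm.const_mul _)
  calc _ ≤ ∫ ξ in Ioo (0 : ℝ) 1, ε / (‖f‖ + 1) * ‖f ξ‖ := by
        refine norm_integral_le_of_norm_le i3 ?_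
        filter_upwards [ae_restrict_mem measurableSet_Ioo] with ξ hξ
        rw [← sub_mul, norm_mul, ← Complex.ofReal_sub, Complex.norm_real, ← mul_sub, norm_mul]
        refine mul_le_mul_of_nonneg_right ?_ (norm_nonneg _)
        have h3 := hp (Real.cos (Real.pi * ξ)) ⟨Real.neg_one_le_cos _, Real.cos_le_one _⟩
        rw [h1 ξ hξ, abs_sub_comm] at h3
        calc _ ≤ 1 * ‖φ ξ - p.eval (Real.cos (Real.pi * ξ))‖ :=
              mul_le_mul_of_nonneg_right (Real.abs_sin_le_one _) (norm_nonneg _)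
          _ ≤ _ := by rw [one_mul]; exact h3.le
    _ = ε / (‖f‖ + 1) * ∫ ξ in Ioo (0 : ℝ) 1, ‖f ξ‖ := integral_const_mul _ _
    _ ≤ ε / (‖f‖ + 1) * (‖f‖ + 1) :=
        mul_le_mul_of_nonneg_left (by linarith [integral_norm_le_norm f]) hε'.le
    _ = ε := by field_simp

/-- The product `sin(πξ) f(ξ)` annihilates every test function, hence vanishes almost everywhere,
and `sin(πξ) > 0` on `(0,1)`. -/
theorem eq_zero_of_inner_sineL2 {f : L2} (hf : ∀ n, inner ℂ (sineL2 n) f = 0) : f = 0 := by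
  have hloc : LocallyIntegrableOn (fun ξ => (Real.sin (Real.pi * ξ) : ℂ) * f ξ)
      (Ioo (0 : ℝ) 1) :=
    IntegrableOn.locallyIntegrableOn (integrable_continuous_mul f (by fun_prop))
  have key := isOpen_Ioo.ae_eq_zero_of_integral_contDiff_smul_eq_zero hloc fun ζ h1 h2 h3 => by
    rw [← setIntegral_eq_integral_of_forall_compl_eq_zero (s := Ioo (0 : ℝ) 1)]
    · rw [← integral_sin_mul_continuous_eq_zero hf h1.continuous]
      congr 1 with ξ
      rw [Complex.real_smul]
      push_cast
      ring
    · intro ξ hξ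
      rw [image_eq_zero_of_notMem_tsupport fun hh => hξ (h3 hh), zero_smul]
  rw [Lp.eq_zero_iff_ae_eq_zero]
  refine (ae_restrict_iff' measurableSet_Ioo).2 (key.mono fun ξ h1 h2 => ?_)
  have hs : 0 < Real.sin (Real.pi * ξ) :=
    Real.sin_pos_of_pos_of_lt_pi (mul_pos Real.pi_pos h2.1)
      (by nlinarith [h2.2, Real.pi_pos])
  exact (mul_eq_zero.1 (h1 h2)).resolve_left (by exact_mod_cast hs.ne')

/-- The sine basis of `L²(0,1)`. -/
def sineBasis : HilbertBasis ℕ ℂ L2 :=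
  HilbertBasis.mkOfOrthogonalEqBot orthonormal_sineL2 <| by
    rw [Submodule.eq_bot_iff]
    intro f hf
    rw [Submodule.mem_orthogonal] at hf
    exact eq_zero_of_inner_sineL2 fun n => hf _ (Submodule.subset_span ⟨n, rfl⟩)

theorem coe_sineBasis : ⇑sineBasis = sineL2 := HilbertBasis.coe_mkOfOrthogonalEqBot _ _

/-- Two bounded operators that agree on the basis vectors, whose span is dense, are equal. -/
theorem repr_greenCLM (x : L2) (n : ℕ) :
    sineBasis.repr (greenCLM x) n
      = ((-(((n + 1) * Real.pi) ^ 2)⁻¹ : ℝ) : ℂ) * sineBasis.repr x n := by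
  have hb : ∃ M : ℝ, ∀ n : ℕ, |(-(((n + 1) * Real.pi) ^ 2)⁻¹ : ℝ)| ≤ M := by
    refine ⟨1, fun n => ?_⟩
    rw [abs_neg, abs_of_pos (by positivity)]
    refine inv_le_one_of_one_le₀ (one_le_pow₀ ?_)
    have h1 := Real.pi_gt_three
    have h2 : (0 : ℝ) ≤ n := n.cast_nonneg
    nlinarith
  have h : greenCLM = diag sineBasis _ hb := by
    refine ContinuousLinearMap.ext_on (s := range sineBasis) ?_ ?_
    · rw [Submodule.dense_iff_topologicalClosure_eq_top]
      exact sineBasis.dense_span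
    · rintro _ ⟨m, rfl⟩
      refine ext_repr sineBasis fun k => ?_
      rw [repr_diag]
      conv_lhs => rw [coe_sineBasis, greenCLM_sineL2, ← coe_sineBasis]
      rw [map_smul, sineBasis.repr_self, lp.coeFn_smul, Pi.smul_apply, smul_eq_mul]
      by_cases hk : k = m
      · rw [hk]
      · simp [hk]
  rw [h, repr_diag]

/-- The Dirichlet operator is diagonal in the sine basis. -/
theorem isDiagonal_dirichletOp {a : ℝ} (ha : 0 < a) :
    IsDiagonal (dirichletOp a) sineBasis (fun n => a * ((n + 1) * Real.pi) ^ 2) where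
  exists_le := by
    refine ⟨a, ha, fun n => le_mul_of_one_le_right ha.le (one_le_pow₀ ?_)⟩
    have h1 := Real.pi_gt_three
    have h2 : (0 : ℝ) ≤ n := n.cast_nonneg
    nlinarith
  mem_graph_iff f g := by
    have hn : ∀ n : ℕ, sineBasis.repr (greenCLM ((a : ℂ)⁻¹ • g)) n
        = -((a * ((n + 1) * Real.pi) ^ 2 : ℝ) : ℂ)⁻¹ * sineBasis.repr g n := fun n => by
      rw [repr_greenCLM, map_smul, lp.coeFn_smul, Pi.smul_apply, smul_eq_mul]
      push_cast
      rw [mul_inv]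
      ring
    have hne : ∀ n : ℕ, ((a * ((n + 1) * Real.pi) ^ 2 : ℝ) : ℂ) ≠ 0 := fun n => by
      have : 0 < a * ((n + 1) * Real.pi) ^ 2 := by positivity
      exact_mod_cast this.ne'
    rw [mem_graph_dirichletOp_iff ha.ne']
    constructor
    · intro h n
      rw [h, hn, ← mul_assoc, neg_mul_neg, mul_inv_cancel₀ (hne n), one_mul]
    · intro h
      refine ext_repr sineBasis fun n => ?_
      rw [hn, h n, ← mul_assoc, neg_mul_neg, inv_mul_cancel₀ (hne n), one_mul]

/-! ### The Lyapunov function -/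

/-- Cauchy's formula for repeated integration. -/
theorem integral_prim_eq (g : L2) {ξ : ℝ} (hξ : ξ ∈ Icc (0 : ℝ) 1) :
    ∫ τ in (0 : ℝ)..ξ, prim g τ = ∫ τ in (0 : ℝ)..ξ, ((ξ - τ : ℝ) : ℂ) * g τ := by
  have h := integral_smul_primitive (integrable_indicator_L2 g) (η := id) (η' := fun _ => 1)
    (fun x => hasDerivAt_id x) continuous_const hξ.1
  simp only [one_smul, id, Complex.real_smul] at h
  rw [← intervalIntegral_indicator g (left_mem_Icc.2 zero_le_one) hξ, ← h]
  rfl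

theorem intervalIntegrable_mul_L2 (g : L2) {w : ℝ → ℝ} (hw : Continuous w) {s t : ℝ}
    (hs : s ∈ Icc (0 : ℝ) 1) (ht : t ∈ Icc (0 : ℝ) 1) :
    IntervalIntegrable (fun τ => (w τ : ℂ) * g τ) volume s t := by
  have h := integrable_continuous_mul g hw
  have h1 : IntervalIntegrable (fun τ => (w τ : ℂ) * g τ) volume 0 1 := by
    rwa [intervalIntegrable_iff_integrableOn_Ioo_of_le zero_le_one]
  refine h1.mono_set ?_
  rw [uIcc_of_le zero_le_one]
  exact uIcc_subset_Icc hs ht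

/-- Split `∫₀¹ (ξ - τ) g` at `ξ` and use `ξ - τ = ξ(1 - τ) - (1 - ξ)τ`. -/
theorem neg_green_eq (g : L2) {ξ : ℝ} (hξ : ξ ∈ Icc (0 : ℝ) 1) :
    -green g ξ = (∫ τ in ξ..(1 : ℝ), ((ξ - τ : ℝ) : ℂ) * g τ)
      + ((1 - ξ : ℝ) : ℂ) * ∫ τ in (0 : ℝ)..1, (τ : ℂ) * g τ := by
  have m0 := left_mem_Icc.2 (zero_le_one (α := ℝ))
  have m1 := right_mem_Icc.2 (zero_le_one (α := ℝ))
  have h1 := intervalIntegral.integral_add_adjacent_intervals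
    (intervalIntegrable_mul_L2 g (w := fun τ => ξ - τ) (by fun_prop) m0 hξ)
    (intervalIntegrable_mul_L2 g (w := fun τ => ξ - τ) (by fun_prop) hξ m1)
  have h2 : ∫ τ in (0 : ℝ)..1, ((ξ - τ : ℝ) : ℂ) * g τ
      = (ξ : ℂ) * (∫ τ in (0 : ℝ)..1, ((1 - τ : ℝ) : ℂ) * g τ)
        - ((1 - ξ : ℝ) : ℂ) * ∫ τ in (0 : ℝ)..1, (τ : ℂ) * g τ := by
    rw [← intervalIntegral.integral_const_mul, ← intervalIntegral.integral_const_mul,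
      ← intervalIntegral.integral_sub
        ((intervalIntegrable_mul_L2 g (w := fun τ => 1 - τ) (by fun_prop) m0 m1).const_mul _)
        ((intervalIntegrable_mul_L2 g (w := fun τ => τ) (by fun_prop) m0 m1).const_mul _)]
    congr 1 with τ
    push_cast
    ring
  rw [green, integral_prim_eq g hξ, integral_prim_eq g m1]
  linear_combination -h2 - h1

theorem resolventOp_dirichletOp {a : ℝ} (ha : 0 < a) (x : L2) :
    resolventOp (dirichletOp a) 0 x = -(a : ℂ)⁻¹ • greenCLM x := by
  have h := ((isDiagonal_dirichletOp ha).mem_graph_iff' (resolventOp (dirichletOp a) 0 x)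
    (-x)).2 (by simp)
  rw [mem_graph_dirichletOp_iff ha.ne'] at h
  rw [h, map_smul, map_neg, smul_neg, neg_smul]

theorem neg_inner_dirichletInv (a : ℝ) (x : L2) :
    -inner ℂ x (dirichletInv a x) = inner ℂ x (resolventOp (dirichletOp a) 0 x) := by
  rw [dirichletInv, _root_.neg_apply, inner_neg_right, neg_neg]

/-- Symmetry of the resolvent makes the inner product equal to its conjugate, so taking the real
part loses nothing. -/
theorem ofReal_heatV {a : ℝ} (ha : 0 < a) (x : L2) :
    ((heatV a x : ℝ) : ℂ) = -inner ℂ x (dirichletInv a x) := by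
  rw [heatV, neg_inner_dirichletInv]
  refine Complex.conj_eq_iff_re.1 ?_
  rw [inner_conj_symm, (isDiagonal_dirichletOp ha).resolventOp_symmetric]

theorem heatV_eq_integral {a : ℝ} (ha : 0 < a) (x : L2) :
    ((heatV a x : ℝ) : ℂ) = (1 / (a : ℂ)) * ∫ ξ in (0 : ℝ)..1,
      ((∫ τ in ξ..(1 : ℝ), ((ξ - τ : ℝ) : ℂ) * x τ) +
        ((1 - ξ : ℝ) : ℂ) * ∫ τ in (0 : ℝ)..1, (τ : ℂ) * x τ) * conj (x ξ) := by
  rw [ofReal_heatV ha, neg_inner_dirichletInv, resolventOp_dirichletOp ha, inner_smul_right,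
    one_div, neg_mul, ← mul_neg, ← inner_neg_right, ← setIntegral_Ioo_eq, L2.inner_def]
  congr 1
  refine integral_congr_ae ?_
  filter_upwards [coeFn_ofCont (green x) (continuous_green x), Lp.coeFn_neg (greenCLM x),
    ae_restrict_mem measurableSet_Ioo] with ξ h1 h2 h3
  rw [h2, Pi.neg_apply, greenCLM_apply, greenL2, h1, neg_green_eq x (Ioo_subset_Icc_self h3),
    RCLike.inner_apply]

/-! ### The boundary input -/

/-- The element `ξ ↦ ξ` of `L²(0,1)`. -/
def idL2 : L2 := ofCont (fun ξ => (ξ : ℂ)) Complex.continuous_ofReal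

theorem hasSecondWeakDeriv_idL2 : HasSecondWeakDeriv idL2 0 := by
  refine ⟨_, ?_, isWeakDeriv_const 1⟩
  have := isWeakDeriv_mul_ofReal 1
  simp only [one_mul] at this
  exact this

/-- Subtracting `c` times `idL2` from `z` removes the boundary value at `1`, keeps the one at `0`
and leaves the second derivative unchanged. -/
theorem isBoundaryInputOp {a : ℝ} (ha : 0 < a) :
    IsBoundaryInputOp a (isDiagonal_dirichletOp ha).semigroup
      ((isDiagonal_dirichletOp ha).inputOp idL2) := by
  intro z z'' c h h0 h1
  refine (isDiagonal_dirichletOp ha).generatorMapsTo_extend idL2 z _ c ?_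
  rw [mem_graph_dirichletOp]
  have k0 : HasValueAt idL2 0 0 := by
    have := hasValueAt_ofCont (fun ξ => (ξ : ℂ)) Complex.continuous_ofReal 0
    rwa [Complex.ofReal_zero] at this
  have k1 : HasValueAt idL2 1 1 := by
    have := hasValueAt_ofCont (fun ξ => (ξ : ℂ)) Complex.continuous_ofReal 1
    rwa [Complex.ofReal_one] at this
  refine ⟨z'', ?_, ?_, ?_, rfl⟩
  · simpa [sub_eq_add_neg] using h.add (hasSecondWeakDeriv_idL2.smul (-c))
  · simpa [sub_eq_add_neg] using h0.add (k0.smul (-c))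
  · simpa [sub_eq_add_neg] using h1.add (k1.smul (-c))

end HeatISS

end

theorem mainTheorem9 (a : ℝ) (ha : 0 < a) :
    HeatISS.InResolventSet (HeatISS.dirichletOp a) 0 ∧
    (∀ x : HeatISS.L2,
      ((HeatISS.heatV a x : ℝ) : ℂ) = -inner ℂ x (HeatISS.dirichletInv a x) ∧
      ((HeatISS.heatV a x : ℝ) : ℂ) =
        (1 / (a : ℂ)) * ∫ ξ in (0 : ℝ)..1,
          ((∫ τ in ξ..(1 : ℝ), ((ξ - τ : ℝ) : ℂ) * x τ) +
            ((1 - ξ : ℝ) : ℂ) * ∫ τ in (0 : ℝ)..1, (τ : ℂ) * x τ) * conj (x ξ)) ∧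
    ∃ (T : ℝ → HeatISS.L2 →L[ℂ] HeatISS.L2) (B : ℂ →L[ℂ] HeatISS.HeatXm1 a)
      (φ : ℝ → HeatISS.L2 → HeatISS.Input ℂ → HeatISS.L2),
      HeatISS.IsC0Semigroup T ∧
      HeatISS.IsGenerator (HeatISS.dirichletOp a) T ∧
      HeatISS.IsBoundaryInputOp a T B ∧
      HeatISS.IsMildSolutionMap (HeatISS.dirichletOp a) 0 T B φ ∧
      HeatISS.IsForwardComplete φ ∧
      HeatISS.IsNoncoerciveISSLyapunov φ (HeatISS.heatV a) ∧
      HeatISS.IsISS φ := by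
  have hA := HeatISS.isDiagonal_dirichletOp ha
  have hV : HeatISS.heatV a
      = fun x => (inner ℂ x (HeatISS.resolventOp (HeatISS.dirichletOp a) 0 x)).re :=
    funext fun x => congrArg Complex.re (HeatISS.neg_inner_dirichletInv a x)
  refine ⟨⟨_, hA.isResolventOp⟩,
    fun x => ⟨HeatISS.ofReal_heatV ha x, HeatISS.heatV_eq_integral ha x⟩,
    hA.semigroup, hA.inputOp HeatISS.idL2, hA.flow HeatISS.idL2, hA.isC0Semigroup,
    hA.isGenerator, HeatISS.isBoundaryInputOp ha, hA.isMildSolutionMap _,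
    hA.isForwardComplete _, ?_, hA.isISS _⟩
  rw [hV]
  exact hA.isNoncoerciveISSLyapunov _
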